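/- Let $V$ be a finite-dimensional real vector space, $\sigma \subset V$ a nonzero strictly convex polyhedral cone (for instance a rational one in $N_{\mathbb R}$), $d=\dim\sigma\ge 1$, and $l$ a linear functional on $V$ with $l\ge 0$ on $\sigma$ and $\{l=0\}\cap\sigma=\{0\}$. Put $P=\sigma\cap\{l=1\}$, a polytope of dimension $d-1$. For each nonzero face $\mu$ of $\sigma$ choose a point $\rho_\mu\in P$ in the relative interior of $\mu$. Let $\Sigma_Y$ be the collection of all faces of the cones $\mathrm{span}_{\mathbb R_{\ge 0}}\{\rho_{\mu_1},\dots,\rho_{\mu_d}\}$, where $\mu_1\subset\mu_2\subset\dots\subset\mu_d=\sigma$ are faces of $\sigma$ with $\dim\mu_i=i$, and let $\mathcal C_Y=\{\tau\cap\{l=1\}:\tau\in\Sigma_Y\}$. A polytopal complex is a finite non-empty collection of polytopes that contains all faces (including $\emptyset$) of its members and in which the intersection of any two members is a face of both; its facets are its inclusion-maximal members; it is pure if all its facets have the same dimension. For a polytope $F$, $\partial F$ denotes the complex of its proper faces. A shelling of a pure complex $\mathcal C$ is a linear ordering $F_1,\dots,F_s$ of its facets such that either all members of $\mathcal C$ are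 points or empty, or each $\partial F_j$ has a shelling $G_1,\dots,G_t$ such that, if $j>1$, then $F_j\cap\bigcup_{i<j}F_i=G_1\cup\dots\cup G_r$ for some $1\le r\le t$. A complex is shellable if it is a pure polytopal complex that has a shelling. Then $\mathcal C_Y$ is a pure simplicial polytopal complex, and it is shellable. More precisely: (a) One can choose, for every chain $P=F^{(d-1)}\supset F^{(d-2)}\supset\dots\supset F^{(i)}$ with $i\ge 1$ in which each member is a facet of the preceding one, a linear order $\prec_{F^{(d-1)},\dots,F^{(i)}}$ on the facets of $F^{(i)}$ that is a shelling of $\partial F^{(i)}$ and such that, if $i<d-1$, $$F^{(i)}\cap\bigcup_{G\,\prec_{F^{(d-1)},\dots,F^{(i+1)}}F^{(i)}}G$$ is the union of an initial (possibly empty) segment of this shelling. (b) For every such choice, list all complete flags $P=F^{(d-1)}\supset\dots\supset F^{(0)}$ (each member a facet of the preceding one, $F^{(0)}$ a vertex) in increasing lexicographic order: $(F^{(\bullet)})\prec(G^{(\bullet)})$ if $F^{(k)}\prec_{F^{(d-1)},\dots,F^{(k+1)}}G^{(k)}$ for the largest $k$ with $F^{(k)}\ne G^{(k)}$. Then the corresponding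 simplices, with vertices $\rho_{\mathrm{span}_{\mathbb R_{\ge0}}F^{(i)}}$ for $0\le i\le d-1$, form in this order a shelling of $\mathcal C_Y$. -/

import Mathlib

/-! ### Polytopes and polytopal complexes

Polytopes are subsets of a finite-dimensional real normed space `V`. The faces of a polytope `P`
(including `∅` and `P` itself) are its exposed subsets `IsExposed ℝ P F`: the empty set and the
sets of maximizers over `P` of a linear functional. -/

section PolytopalComplex

variable {V : Type*} [NormedAddCommGroup V] [NormedSpace ℝ V]

/-- A polytope: the convex hull of finitely many points (the empty polytope is allowed). -/
def IsPolytope (P : Set V) : Prop :=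
  ∃ s : Finset V, P = convexHull ℝ (s : Set V)

/-- A simplex: the convex hull of finitely many affinely independent points. -/
def IsSimplex (P : Set V) : Prop :=
  ∃ s : Finset V, AffineIndependent ℝ ((↑) : s → V) ∧ P = convexHull ℝ (s : Set V)

/-- A polytopal complex: a finite, non-empty collection of polytopes that contains the faces of all
its members, and in which any two members meet in a common face. -/
structure IsPolytopalComplex (C : Set (Set V)) : Prop where
  finite : C.Finite
  nonempty : C.Nonempty
  isPolytope : ∀ P ∈ C, IsPolytope P
  face_mem : ∀ P ∈ C, ∀ F, IsExposed ℝ P F → F ∈ C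
  inter_left : ∀ P ∈ C, ∀ Q ∈ C, IsExposed ℝ P (P ∩ Q)
  inter_right : ∀ P ∈ C, ∀ Q ∈ C, IsExposed ℝ Q (P ∩ Q)

/-- The facets of a complex: its inclusion-maximal members. -/
def complexFacets (C : Set (Set V)) : Set (Set V) :=
  {F | Maximal (· ∈ C) F}

/-- A complex is pure if all its facets have the same dimension. (The dimension used here is `0`
both for `∅` and for a point, but `∅` is a facet of a complex only if it is the only member.) -/
def IsPureComplex (C : Set (Set V)) : Prop :=
  ∀ F ∈ complexFacets C, ∀ G ∈ complexFacets C,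
    Module.finrank ℝ (vectorSpan ℝ F) = Module.finrank ℝ (vectorSpan ℝ G)

/-- A complex is simplicial if all its members are simplices. -/
def IsSimplicialComplex (C : Set (Set V)) : Prop :=
  ∀ F ∈ C, IsSimplex F

/-- The boundary complex of a polytope: the set of its proper faces. -/
def boundaryComplex (P : Set V) : Set (Set V) :=
  {F | IsExposed ℝ P F ∧ F ≠ P}

/-! ### Shellings -/

/-- The list `L` enumerates the facets of `C`, each exactly once. -/
def IsFacetOrdering (C : Set (Set V)) (L : List (Set V)) : Prop :=
  L.Nodup ∧ ∀ F, F ∈ L ↔ F ∈ complexFacets C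

/-- Shellings of a pure polytopal complex `C`. If `C` is a set of points, every ordering of its
facets is a shelling. In general an ordering `F₁, …, Fₛ` of the facets is a shelling if every
boundary complex `∂Fⱼ` has a shelling `G₁, …, Gₜ` such that, for `j > 1`, the intersection of `Fⱼ`
with the union of `F₁, …, Fⱼ₋₁` is `G₁ ∪ ⋯ ∪ Gᵣ` for some `1 ≤ r ≤ t`. -/
inductive IsShelling : Set (Set V) → List (Set V) → Prop
  | points (C : Set (Set V)) (L : List (Set V)) (hL : IsFacetOrdering C L)
      (hC : ∀ F ∈ C, F.Subsingleton) : IsShelling C L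
  | step (C : Set (Set V)) (L : List (Set V)) (hL : IsFacetOrdering C L)
      (M : Fin L.length → List (Set V))
      (hM : ∀ j, IsShelling (boundaryComplex (L.get j)) (M j))
      (hinter : ∀ j : Fin L.length, 0 < (j : ℕ) → ∃ r : ℕ, 1 ≤ r ∧ r ≤ (M j).length ∧
        L.get j ∩ (⋃ K ∈ L.take j, K) = ⋃ G ∈ (M j).take r, G) :
      IsShelling C L

/-- A complex is shellable if it is a pure polytopal complex that has a shelling. -/
def IsShellable (C : Set (Set V)) : Prop :=
  IsPolytopalComplex C ∧ IsPureComplex C ∧ ∃ L, IsShelling C L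

/-! ### The lexicographic order on flags of faces of a polytope -/

/-- `c = [Fₙ, Fₙ₋₁, …, Fᵢ]` is a chain of faces of `P = Fₙ` in which each member is a facet of the
preceding one. -/
def IsFacetChain (P : Set V) (c : List (Set V)) : Prop :=
  c.head? = some P ∧ c.IsChain (fun G F => F ∈ complexFacets (boundaryComplex G))

/-- A complete flag of faces of `P`: a chain `P = Fₙ ⊃ Fₙ₋₁ ⊃ ⋯ ⊃ F₀`, each member a facet of the
preceding one, that ends in a vertex `F₀`. -/
def IsCompleteFlag (P : Set V) (c : List (Set V)) : Prop :=
  IsFacetChain P c ∧ ∃ v : V, c.getLast? = some {v}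

/-- `F` occurs strictly before `G` in the (duplicate-free) list `L`. -/
def Precedes (L : List (Set V)) (F G : Set V) : Prop :=
  [F, G].Sublist L

/-- A recursive choice of shellings. To each chain `Fₙ ⊃ ⋯ ⊃ Fᵢ` of faces of `P = Fₙ` as above, with
`dim Fᵢ ≥ 1`, the function `ord` assigns a shelling of `∂Fᵢ`. For `i < n`, the intersection of `Fᵢ`
with the union of the facets of `Fᵢ₊₁` that come before `Fᵢ` in the order assigned to
`Fₙ ⊃ ⋯ ⊃ Fᵢ₊₁` is the union of an initial segment of this shelling. -/
structure IsRecursiveShelling (P : Set V) (ord : List (Set V) → List (Set V)) : Prop where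
  shelling : ∀ (p : List (Set V)) (F : Set V), IsFacetChain P (p ++ [F]) → F.Nontrivial →
    IsShelling (boundaryComplex F) (ord (p ++ [F]))
  initial : ∀ (p : List (Set V)) (G F : Set V), IsFacetChain P (p ++ [G, F]) → F.Nontrivial →
    ∃ r : ℕ, r ≤ (ord (p ++ [G, F])).length ∧
      F ∩ (⋃ K ∈ {K | Precedes (ord (p ++ [G])) K F}, K) =
        ⋃ H ∈ (ord (p ++ [G, F])).take r, H

/-- The lexicographic order on flags: at the first (that is, largest-dimensional) place where the
two flags differ, the entry of the first comes before the entry of the second in the order that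
`ord` assigns to the common part above. -/
def FlagLT (ord : List (Set V) → List (Set V)) (c c' : List (Set V)) : Prop :=
  ∃ (p s t : List (Set V)) (F G : Set V),
    c = p ++ F :: s ∧ c' = p ++ G :: t ∧ F ≠ G ∧ Precedes (ord p) F G

/-- `L` is the list of all complete flags of `P`, in increasing lexicographic order. -/
def IsLexFlagList (P : Set V) (ord : List (Set V) → List (Set V)) (L : List (List (Set V))) :
    Prop :=
  L.Nodup ∧ (∀ c, c ∈ L ↔ IsCompleteFlag P c) ∧ L.Pairwise (FlagLT ord)

/-! ### Barycentric subdivisions of a cone -/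

/-- The dimension of a cone. -/
noncomputable def coneDim (μ : PointedCone ℝ V) : ℕ :=
  Module.finrank ℝ (Submodule.span ℝ (μ : Set V))

/-- The section of a cone by the affine hyperplane `{l = 1}`. -/
def coneSection (l : V →ₗ[ℝ] ℝ) (τ : PointedCone ℝ V) : Set V :=
  {x | x ∈ τ ∧ l x = 1}

/-- A complete flag `μ₁ ⊂ μ₂ ⊂ ⋯ ⊂ μ_d = σ` of faces of `σ`, where `d = dim σ` and `dim μᵢ = i`
(the index set `Fin d` starts at `0`, so `μ i` has dimension `i + 1`). -/
def IsConeFlag (σ : PointedCone ℝ V) (μ : Fin (coneDim σ) → PointedCone ℝ V) : Prop :=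
  Monotone μ ∧ ∀ i, (μ i).IsFaceOf σ ∧ coneDim (μ i) = (i : ℕ) + 1

/-- The barycentric subdivision of `σ` with respect to points `ρ μ` in the relative interiors of
the nonzero faces `μ` of `σ`: the fan whose maximal cones are the cones spanned by
`ρ μ₁, …, ρ μ_d`, for the complete flags `μ₁ ⊂ ⋯ ⊂ μ_d` of `σ`; it consists of all faces of these. -/
def barycentricFan (σ : PointedCone ℝ V) (ρ : PointedCone ℝ V → V) : Set (PointedCone ℝ V) :=
  {τ | ∃ μ : Fin (coneDim σ) → PointedCone ℝ V, IsConeFlag σ μ ∧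
    τ.IsFaceOf (PointedCone.hull ℝ (Set.range fun i => ρ (μ i)))}

/-- The complex over which the barycentric subdivision of `σ` is the cone: it consists of the
sections of the cones of the subdivision by the hyperplane `{l = 1}`, on which the `ρ μ` lie. -/
def barycentricComplex (σ : PointedCone ℝ V) (l : V →ₗ[ℝ] ℝ) (ρ : PointedCone ℝ V → V) :
    Set (Set V) :=
  coneSection l '' barycentricFan σ ρ

/-- The simplex whose vertices are the points `ρ` of the cones spanned by the members of a flag of
faces of the polytope `σ ∩ {l = 1}`. -/
def flagSimplex (ρ : PointedCone ℝ V → V) (c : List (Set V)) : Set V :=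
  convexHull ℝ {x | ∃ F ∈ c, x = ρ (PointedCone.hull ℝ F)}

end PolytopalComplex

/-! Since `l = 1` on `P = σ ∩ {l = 1}`, affine functionals on `P` are restrictions of linear ones,
and a face is the zero set in `P` of a linear functional nonnegative on `P` (`Cuts`). The rank of
the linear span plays the role of the dimension, shifted by one: `∅` has rank 0, a vertex rank 1.

Part (a). The recursive definition of a shelling already supplies, for each facet, a shelling of its
boundary starting with the intersection with earlier facets. So it suffices to shell the boundary of
`P`, which is done by a line shelling (`PolytopeIn.exists_line_shelling`). For the induction one
proves more: for generic `c` there is a shelling starting with the facets visible from `c`. Take a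
generic interior `o` and sort the facets by the parameter `κ F` at which `c - κ • o` meets the span
of `F`, at a point `cf F`. A facet `F ∩ H` of `F` is visible from `cf F` exactly when `κ H < κ F`;
so `F` meets the earlier facets in the facets of `F` visible from `cf F`, and induction applies to
`F` and `cf F`.

Part (b). Simplices on chains of faces meet in the simplex on the common members
(`IsBarycenter.chainSimplex_inter`), and any order of the facets of a simplex shells its boundary
(`IsBarycenter.isShelling_boundary`). What remains is combinatorial
(`IsRecursiveShelling.exchange`): if the flag `y` precedes `x`, some `z` preceding `x` contains all
of `x` except one `F₀ ∉ y`. Then the simplices of `x` and `y` meet inside the ridge of `x` opposite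
`F₀`, and that ridge lies in the simplex of `z`.

To find `z`, let `x` and `y` first differ at `F` and `G`, and let `D` be their next common member.
If the member `F'` of `x` after `F` lies in a facet preceding `F`, for instance if `F' = D ⊆ G`,
that facet replaces `F`. Otherwise `F'` is not in the initial segment of the shelling of `∂F`, while
`D ⊆ F ∩ G` lies in some `H` of that segment. So `H` precedes `F'`, and the argument repeats one
step down with `F'` and `H`.

Finally `barycentricComplex_eq_flagComplex` translates from cones to flags; it rests on the fact
that faces of polyhedral cones are exposed. -/

open Set

/-! ### Faces of polytopes as zero sets of nonnegative functionals. -/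

section Cutting

variable {V : Type*} [NormedAddCommGroup V] [NormedSpace ℝ V]

/-- A polytope in the affine hyperplane `{l = 1}`. -/
def PolytopeIn (l : V →ₗ[ℝ] ℝ) (P : Set V) : Prop :=
  ∃ s : Finset V, P = convexHull ℝ (s : Set V) ∧ ∀ x ∈ s, l x = 1

/-- The functional `a` is nonnegative on `P` and vanishes exactly on the subset `F`. -/
structure Cuts (a : V →ₗ[ℝ] ℝ) (P F : Set V) : Prop where
  nonneg : ∀ x ∈ P, 0 ≤ a x
  mem_iff : ∀ x, x ∈ F ↔ x ∈ P ∧ a x = 0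

namespace Cuts

variable {a b : V →ₗ[ℝ] ℝ} {P F G : Set V}

lemma subset (h : Cuts a P F) : F ⊆ P := fun x hx => ((h.mem_iff x).1 hx).1

lemma eq_zero (h : Cuts a P F) {x : V} (hx : x ∈ F) : a x = 0 := ((h.mem_iff x).1 hx).2

lemma pos (h : Cuts a P F) {x : V} (hx : x ∈ P) (hF : x ∉ F) : 0 < a x :=
  lt_of_le_of_ne (h.nonneg x hx) fun h0 => hF ((h.mem_iff x).2 ⟨hx, h0.symm⟩)

lemma self (P : Set V) : Cuts (0 : V →ₗ[ℝ] ℝ) P P := ⟨by simp, by simp⟩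

lemma restrict (hF : Cuts a P F) {Q : Set V} (hQ : Q ⊆ P) : Cuts a Q (F ∩ Q) where
  nonneg x hx := hF.nonneg x (hQ hx)
  mem_iff x := by
    constructor
    · rintro ⟨h1, h2⟩; exact ⟨h2, hF.eq_zero h1⟩
    · rintro ⟨h1, h2⟩; exact ⟨(hF.mem_iff x).2 ⟨hQ h1, h2⟩, h1⟩

lemma restrict_of_subset (hF : Cuts a P F) {Q : Set V} (hQ : Q ⊆ P) (hFQ : F ⊆ Q) :
    Cuts a Q F := by
  simpa [inter_eq_left.2 hFQ] using hF.restrict hQ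

lemma empty {l : V →ₗ[ℝ] ℝ} (hl : ∀ x ∈ P, l x = 1) : Cuts l P ∅ where
  nonneg x hx := by simp [hl x hx]
  mem_iff x := by
    constructor
    · simp
    · rintro ⟨hx, h0⟩
      simp [hl x hx] at h0

end Cuts

lemma convexHull_finset_of_nonneg {s : Finset V} {a : V →ₗ[ℝ] ℝ} (ha : ∀ x ∈ s, 0 ≤ a x)
    {x : V} (hx : x ∈ convexHull ℝ (s : Set V)) : 0 ≤ a x := by
  have : convexHull ℝ (s : Set V) ⊆ {x | 0 ≤ a x} :=
    convexHull_min (fun x hx => ha x hx) (convex_halfSpace_ge a.isLinear 0)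
  exact this hx

lemma mem_convexHull_filter_of_eq_zero {s : Finset V} {a : V →ₗ[ℝ] ℝ} (ha : ∀ x ∈ s, 0 ≤ a x)
    {x : V} (hx : x ∈ convexHull ℝ (s : Set V)) (h0 : a x = 0) :
    x ∈ convexHull ℝ {y | y ∈ s ∧ a y = 0} := by
  classical
  obtain ⟨w, hw, hw1, rfl⟩ := Finset.mem_convexHull'.1 hx
  have hz : ∀ y ∈ s, w y * a y = 0 := by
    rw [← Finset.sum_eq_zero_iff_of_nonneg fun y hy => mul_nonneg (hw y hy) (ha y hy)]
    simpa [map_sum] using h0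
  have hw0 : ∀ y ∈ s, y ∉ s.filter (fun y => a y = 0) → w y = 0 := by
    intro y hy hy'
    rcases mul_eq_zero.1 (hz y hy) with h | h
    · exact h
    · exact absurd (Finset.mem_filter.2 ⟨hy, h⟩) hy'
  have : ∑ y ∈ s, w y • y ∈ convexHull ℝ ((s.filter (fun y => a y = 0) : Finset V) : Set V) := by
    refine Finset.mem_convexHull'.2 ⟨w, fun y hy => hw y (Finset.mem_filter.1 hy).1, ?_, ?_⟩
    · rw [← hw1]
      exact Finset.sum_subset (Finset.filter_subset _ _) hw0
    · exact Finset.sum_subset (Finset.filter_subset _ _) fun y hy hy' => by simp [hw0 y hy hy']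
  simpa using this

lemma Cuts.eq_convexHull {s : Finset V} {a : V →ₗ[ℝ] ℝ} {F : Set V}
    (h : Cuts a (convexHull ℝ (s : Set V)) F) : F = convexHull ℝ {y | y ∈ s ∧ a y = 0} := by
  apply Subset.antisymm
  · intro x hx
    exact mem_convexHull_filter_of_eq_zero (fun y hy => h.nonneg y (subset_convexHull ℝ _ hy))
      (h.subset hx) (h.eq_zero hx)
  · intro x hx
    refine (h.mem_iff x).2 ⟨convexHull_mono (fun y hy => hy.1) hx, ?_⟩
    have : convexHull ℝ {y | y ∈ s ∧ a y = 0} ⊆ {x | a x = 0} :=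
      convexHull_min (fun y hy => hy.2) (convex_hyperplane a.isLinear 0)
    exact this hx

/-- A functional that is nonnegative on the generators cuts out the face spanned by the generators at
which it vanishes. -/
lemma cuts_of_generators {s : Finset V} {a : V →ₗ[ℝ] ℝ} (ha : ∀ x ∈ s, 0 ≤ a x) :
    Cuts a (convexHull ℝ (s : Set V)) (convexHull ℝ {y | y ∈ s ∧ a y = 0}) where
  nonneg x hx := convexHull_finset_of_nonneg ha hx
  mem_iff x := by
    constructor
    · intro hx
      refine ⟨convexHull_mono (fun y hy => hy.1) hx, ?_⟩
      have : convexHull ℝ {y | y ∈ s ∧ a y = 0} ⊆ {x | a x = 0} :=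
        convexHull_min (fun y hy => hy.2) (convex_hyperplane a.isLinear 0)
      exact this hx
    · rintro ⟨hx, h0⟩
      exact mem_convexHull_filter_of_eq_zero ha hx h0

namespace PolytopeIn

variable {l : V →ₗ[ℝ] ℝ} {P F G : Set V} {a b c : V →ₗ[ℝ] ℝ}

lemma isPolytope (hP : PolytopeIn l P) : IsPolytope P := by
  obtain ⟨s, hs, -⟩ := hP; exact ⟨s, hs⟩

lemma convex (hP : PolytopeIn l P) : Convex ℝ P := by
  obtain ⟨s, rfl, -⟩ := hP; exact convex_convexHull ℝ _

lemma apply_eq_one (hP : PolytopeIn l P) {x : V} (hx : x ∈ P) : l x = 1 := by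
  obtain ⟨s, rfl, hs⟩ := hP
  have : convexHull ℝ (s : Set V) ⊆ {x | l x = 1} :=
    convexHull_min (fun y hy => hs y hy) (convex_hyperplane l.isLinear 1)
  exact this hx

lemma isCompact (hP : PolytopeIn l P) : IsCompact P := by
  obtain ⟨s, rfl, -⟩ := hP
  exact s.finite_toSet.isCompact_convexHull ℝ

lemma cuts_empty (hP : PolytopeIn l P) : Cuts l P ∅ := Cuts.empty fun _ hx => hP.apply_eq_one hx

lemma of_cuts (hP : PolytopeIn l P) (h : Cuts a P F) : PolytopeIn l F := by
  classical
  obtain ⟨s, rfl, hs⟩ := hP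
  refine ⟨s.filter (fun y => a y = 0), ?_, fun x hx => hs x (Finset.mem_filter.1 hx).1⟩
  rw [h.eq_convexHull]; simp

lemma finite_faces (hP : PolytopeIn l P) : {F | ∃ a : V →ₗ[ℝ] ℝ, Cuts a P F}.Finite := by
  classical
  obtain ⟨s, rfl, hs⟩ := hP
  refine ((s.powerset.finite_toSet).image
    (fun t : Finset V => convexHull ℝ (t : Set V))).subset ?_
  rintro F ⟨a, ha⟩
  refine ⟨s.filter (fun y => a y = 0),
    Finset.mem_coe.2 (Finset.mem_powerset.2 (Finset.filter_subset _ _)), ?_⟩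
  rw [ha.eq_convexHull]; simp

/-- A functional that cuts out a face can be perturbed by one that is nonnegative on that face. -/
lemma exists_perturb (hP : PolytopeIn l P) (hb : Cuts b P F) (hc : Cuts c F G) :
    ∃ ε : ℝ, 0 < ε ∧ Cuts (b + ε • c) P G := by
  obtain ⟨s, rfl, hs⟩ := hP
  -- Quantifying over all `δ ≤ ε` lets the bound shrink as generators are added one at a time.
  have key : ∀ t : Finset V, t ⊆ s → ∃ ε : ℝ, 0 < ε ∧ ∀ δ, 0 < δ → δ ≤ ε → ∀ y ∈ t,
      0 ≤ b y + δ * c y ∧ (b y + δ * c y = 0 → y ∈ G) := by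
    classical
    intro t
    induction t using Finset.induction_on with
    | empty => intro _; exact ⟨1, one_pos, by simp⟩
    | insert y t hy ih =>
      intro hts
      obtain ⟨ε, hε, h⟩ := ih ((Finset.subset_insert _ _).trans hts)
      have hyP : y ∈ convexHull ℝ (s : Set V) :=
        subset_convexHull ℝ _ (hts (Finset.mem_insert_self _ _))
      by_cases hyF : y ∈ F
      · refine ⟨ε, hε, fun δ hδ hδε z hz => ?_⟩
        rcases Finset.mem_insert.1 hz with rfl | hz
        · rw [hb.eq_zero hyF, zero_add]
          refine ⟨mul_nonneg hδ.le (hc.nonneg _ hyF), fun h0 => (hc.mem_iff _).2 ⟨hyF, ?_⟩⟩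
          exact (mul_eq_zero.1 h0).resolve_left hδ.ne'
        · exact h δ hδ hδε z hz
      · have hby := hb.pos hyP hyF
        have hd : 0 < |c y| + 1 := by positivity
        -- This bound keeps `δ * |c y|` at most half of `b y`.
        refine ⟨min ε (b y / (2 * (|c y| + 1))), by positivity, fun δ hδ hδε z hz => ?_⟩
        rcases Finset.mem_insert.1 hz with rfl | hz
        · have h1 : δ ≤ b z / (2 * (|c z| + 1)) := hδε.trans (min_le_right _ _)
          rw [le_div_iff₀ (by positivity)] at h1
          have h2 := neg_abs_le (c z)
          have : 0 < b z + δ * c z := by nlinarith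
          exact ⟨this.le, fun h0 => absurd h0 this.ne'⟩
        · exact h δ hδ (hδε.trans (min_le_left _ _)) z hz
  obtain ⟨ε, hε, h⟩ := key s subset_rfl
  refine ⟨ε, hε, ?_⟩
  have hpos : ∀ x ∈ s, 0 ≤ (b + ε • c) x := fun x hx => by
    simpa using (h ε hε le_rfl x hx).1
  have hcut := cuts_of_generators hpos
  refine ⟨hcut.nonneg, fun x => ⟨fun hx => ?_, fun hx => ?_⟩⟩
  · have hxF := hc.subset hx
    exact ⟨hb.subset hxF, by simp [hb.eq_zero hxF, hc.eq_zero hx]⟩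
  · have hx' := (hcut.mem_iff x).2 hx
    have hQ : PolytopeIn l (convexHull ℝ (s : Set V)) := ⟨s, rfl, hs⟩
    have hFG : Convex ℝ G := ((hQ.of_cuts hb).of_cuts hc).convex
    refine convexHull_min ?_ hFG hx'
    rintro y ⟨hy, hy0⟩
    exact (h ε hε le_rfl y hy).2 (by simpa using hy0)

lemma cuts_trans (hP : PolytopeIn l P) (hb : Cuts b P F) (hc : Cuts c F G) :
    ∃ a : V →ₗ[ℝ] ℝ, Cuts a P G :=
  let ⟨_, _, h⟩ := hP.exists_perturb hb hc
  ⟨_, h⟩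

/-- Moving a functional that cuts out `F` in a direction that vanishes on `F` and is negative
somewhere on `P`, one reaches a larger face. -/
lemma exists_pencil (hP : PolytopeIn l P) (hb : Cuts b P F) (hc : ∀ x ∈ F, c x = 0)
    (hneg : ∃ x ∈ P, c x < 0) :
    ∃ t : ℝ, 0 < t ∧ ∃ F', Cuts (b + t • c) P F' ∧ F ⊂ F' := by
  classical
  obtain ⟨s, rfl, hs⟩ := hP
  have hne : (s.filter (fun y => c y < 0)).Nonempty := by
    by_contra hcon
    obtain ⟨x, hx, hx0⟩ := hneg
    refine absurd (convexHull_finset_of_nonneg (a := c) (fun y hy => ?_) hx) (not_le.2 hx0)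
    by_contra hy0
    exact hcon ⟨y, Finset.mem_filter.2 ⟨hy, not_le.1 hy0⟩⟩
  -- The minimal ratio is the first `t` at which `b + t • c` vanishes at a generator where `c` is
  -- negative; up to that `t` it is nonnegative on all generators.
  obtain ⟨y, hy, hmin⟩ := Finset.exists_min_image _ (fun y => b y / (-c y)) hne
  rw [Finset.mem_filter] at hy
  have hyP : y ∈ convexHull ℝ (s : Set V) := subset_convexHull ℝ _ hy.1
  have hyF : y ∉ F := fun h => by simp [hc y h] at hy
  have hby := hb.pos hyP hyF
  have hcy : 0 < -c y := by linarith [hy.2]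
  refine ⟨b y / (-c y), by positivity, _, cuts_of_generators ?_, ?_⟩
  · intro x hx
    simp only [LinearMap.add_apply, LinearMap.smul_apply, smul_eq_mul]
    have hbx := hb.nonneg x (subset_convexHull ℝ _ hx)
    rcases lt_or_ge (c x) 0 with h | h
    · have := hmin x (Finset.mem_filter.2 ⟨hx, h⟩)
      rw [le_div_iff₀ (by linarith)] at this
      linarith
    · have : 0 ≤ b y / (-c y) * c x := by positivity
      linarith
  · have hysub : y ∈ convexHull ℝ {z | z ∈ s ∧ (b + (b y / (-c y)) • c) z = 0} := by
      refine subset_convexHull ℝ _ ⟨hy.1, ?_⟩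
      simp only [LinearMap.add_apply, LinearMap.smul_apply, smul_eq_mul]
      rw [div_neg, neg_mul, div_mul_cancel₀ _ (by linarith : c y ≠ 0)]; ring
    refine ⟨?_, fun h => hyF (h hysub)⟩
    rw [hb.eq_convexHull]
    apply convexHull_mono
    rintro z ⟨hz, hz0⟩
    have : c z = 0 := hc z ((hb.mem_iff z).2 ⟨subset_convexHull ℝ _ hz, hz0⟩)
    exact ⟨hz, by simp [hz0, this]⟩

lemma isExposed_iff [FiniteDimensional ℝ V] (hP : PolytopeIn l P) :
    IsExposed ℝ P F ↔ ∃ a : V →ₗ[ℝ] ℝ, Cuts a P F := by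
  constructor
  · intro h
    rcases F.eq_empty_or_nonempty with rfl | hF
    · exact ⟨l, hP.cuts_empty⟩
    · obtain ⟨f, rfl⟩ := h hF
      obtain ⟨z, hz, hzmax⟩ := hF
      -- On `P` this is `max f - f`, made linear by means of `l = 1`.
      refine ⟨f z • l - (f : V →ₗ[ℝ] ℝ), fun x hx => ?_, fun x => ?_⟩
      · simp [hP.apply_eq_one hx, hzmax x hx]
      · simp only [mem_ofPred_eq]
        refine and_congr_right fun hx => ?_
        simp only [LinearMap.sub_apply, LinearMap.smul_apply, hP.apply_eq_one hx, smul_eq_mul,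
          mul_one, ContinuousLinearMap.coe_coe, sub_eq_zero]
        exact ⟨fun h => le_antisymm (h z hz) (hzmax x hx), fun h y hy => h ▸ hzmax y hy⟩
  · rintro ⟨a, ha⟩ ⟨z, hz⟩
    refine ⟨-LinearMap.toContinuousLinearMap a, ?_⟩
    ext x
    rw [ha.mem_iff]
    simp only [neg_apply, LinearMap.coe_toContinuousLinearMap', mem_ofPred_eq,
      neg_le_neg_iff]
    refine and_congr_right fun hx => ⟨fun h y hy => h ▸ ha.nonneg y hy, fun h => ?_⟩
    exact le_antisymm ((h z (ha.subset hz)).trans (ha.eq_zero hz).le) (ha.nonneg x hx)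

end PolytopeIn

end Cutting

/-! ### Facets, their spans, and the cone they bound. -/

section Facets

variable {V : Type*} [NormedAddCommGroup V] [NormedSpace ℝ V]

/-- `F` is a facet of the boundary complex of `P`. -/
def FacetOf (F P : Set V) : Prop := F ∈ complexFacets (boundaryComplex P)

lemma apply_eq_zero_of_mem_span {a : V →ₗ[ℝ] ℝ} {F : Set V} (h : ∀ x ∈ F, a x = 0) {x : V}
    (hx : x ∈ Submodule.span ℝ F) : a x = 0 := by
  have : Submodule.span ℝ F ≤ LinearMap.ker a :=
    Submodule.span_le.2 fun y hy => LinearMap.mem_ker.2 (h y hy)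
  exact this hx

namespace Cuts

variable {a b : V →ₗ[ℝ] ℝ} {P F G : Set V}

lemma apply_span (h : Cuts a P F) {x : V} (hx : x ∈ Submodule.span ℝ F) : a x = 0 :=
  apply_eq_zero_of_mem_span (fun _ hy => h.eq_zero hy) hx

lemma mem_of_mem_span (h : Cuts a P F) {x : V} (hxP : x ∈ P) (hx : x ∈ Submodule.span ℝ F) :
    x ∈ F := (h.mem_iff x).2 ⟨hxP, h.apply_span hx⟩

lemma exists_pos (h : Cuts a P F) (hne : F ≠ P) : ∃ x ∈ P, x ∉ F ∧ 0 < a x := by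
  by_contra hcon
  push Not at hcon
  apply hne
  apply Subset.antisymm h.subset
  intro x hx
  by_contra hxF
  exact absurd (hcon x hx hxF) (not_le.2 (h.pos hx hxF))

lemma span_lt (h : Cuts a P F) (hne : F ≠ P) : Submodule.span ℝ F < Submodule.span ℝ P := by
  refine lt_of_le_of_ne (Submodule.span_mono h.subset) fun heq => hne ?_
  exact Subset.antisymm h.subset fun x hx =>
    h.mem_of_mem_span hx (heq ▸ Submodule.subset_span hx)

lemma finrank_lt [FiniteDimensional ℝ V] (h : Cuts a P F) (hne : F ≠ P) :
    Module.finrank ℝ (Submodule.span ℝ F) < Module.finrank ℝ (Submodule.span ℝ P) :=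
  Submodule.finrank_lt_finrank_of_lt (h.span_lt hne)

end Cuts

namespace PolytopeIn

variable [FiniteDimensional ℝ V] {l : V →ₗ[ℝ] ℝ} {P F G : Set V} {a b c : V →ₗ[ℝ] ℝ}

lemma mem_boundary_iff (hP : PolytopeIn l P) :
    F ∈ boundaryComplex P ↔ (∃ a : V →ₗ[ℝ] ℝ, Cuts a P F) ∧ F ≠ P := by
  simp only [boundaryComplex, mem_ofPred_eq, hP.isExposed_iff]

lemma facetOf_iff (hP : PolytopeIn l P) :
    FacetOf F P ↔ (∃ a : V →ₗ[ℝ] ℝ, Cuts a P F) ∧ F ≠ P ∧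
      ∀ (b : V →ₗ[ℝ] ℝ) (G : Set V), Cuts b P G → G ≠ P → F ⊆ G → G = F := by
  simp only [FacetOf, complexFacets, mem_ofPred_eq, Maximal, hP.mem_boundary_iff]
  constructor
  · rintro ⟨⟨h1, h2⟩, h3⟩
    exact ⟨h1, h2, fun b G hb hG hFG => (h3 ⟨⟨b, hb⟩, hG⟩ hFG).antisymm hFG⟩
  · rintro ⟨h1, h2, h3⟩
    exact ⟨⟨h1, h2⟩, fun G ⟨⟨b, hb⟩, hG⟩ hFG => (h3 b G hb hG hFG).subset⟩

lemma finite_boundary (hP : PolytopeIn l P) : (boundaryComplex P).Finite :=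
  hP.finite_faces.subset fun _ hF => (hP.mem_boundary_iff.1 hF).1

lemma finite_facets (hP : PolytopeIn l P) : {F | FacetOf F P}.Finite :=
  hP.finite_boundary.subset fun _ hF => hF.1

lemma exists_facet (hP : PolytopeIn l P) (ha : Cuts a P F) (hne : F ≠ P) :
    ∃ G, FacetOf G P ∧ F ⊆ G := by
  obtain ⟨G, hFG, hG⟩ := hP.finite_boundary.exists_le_maximal (hP.mem_boundary_iff.2 ⟨⟨a, ha⟩, hne⟩)
  exact ⟨G, hG, hFG⟩

end PolytopeIn

namespace FacetOf

variable {l : V →ₗ[ℝ] ℝ} {P F G : Set V} {a b c : V →ₗ[ℝ] ℝ}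

lemma ne (hF : FacetOf F P) : F ≠ P := hF.1.2

lemma subset (hF : FacetOf F P) : F ⊆ P := hF.1.1.subset

lemma eq_of_subset (hF : FacetOf F P) (hG : FacetOf G P) (h : F ⊆ G) : F = G :=
  Subset.antisymm h (hF.2 hG.1 h)

variable [FiniteDimensional ℝ V]

lemma exists_cuts (hF : FacetOf F P) (hP : PolytopeIn l P) : ∃ a : V →ₗ[ℝ] ℝ, Cuts a P F :=
  (hP.facetOf_iff.1 hF).1

lemma polytopeIn (hF : FacetOf F P) (hP : PolytopeIn l P) : PolytopeIn l F :=
  let ⟨_, ha⟩ := hF.exists_cuts hP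
  hP.of_cuts ha

/-- A facet spans the whole hyperplane `b = 0` of the span of `P`. Otherwise some `c` vanishes on
`F` but not at `x`, and one of `b + t • c`, `b - t • c` cuts out a larger face, proper because its
value at `x` is nonzero. -/
lemma mem_span (hF : FacetOf F P) (hP : PolytopeIn l P) (hb : Cuts b P F) {x : V}
    (hx : x ∈ Submodule.span ℝ P) (hx0 : b x = 0) : x ∈ Submodule.span ℝ F := by
  by_contra hxF
  obtain ⟨c, hcx, hc⟩ := Submodule.exists_le_ker_of_notMem hxF
  have hcF : ∀ y ∈ F, c y = 0 := fun y hy => hc (Submodule.subset_span hy)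
  have key : ∀ c : V →ₗ[ℝ] ℝ, c x ≠ 0 → (∀ y ∈ F, c y = 0) → ¬ ∃ y ∈ P, c y < 0 := by
    intro c hcx hcF hneg
    obtain ⟨t, ht, F', hF', hFF'⟩ := hP.exists_pencil hb hcF hneg
    rcases eq_or_ne F' P with rfl | hne
    · have := hF'.apply_span hx
      simp [hx0, ht.ne', hcx] at this
    · exact hFF'.ne ((hP.facetOf_iff.1 hF).2.2 _ _ hF' hne hFF'.subset).symm
  have h1 := key c hcx hcF
  have h2 := key (-c) (by simpa using hcx) (fun y hy => by simp [hcF y hy])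
  push Not at h1 h2
  refine hcx (apply_eq_zero_of_mem_span (fun y hy => ?_) hx)
  have := h2 y hy
  simp only [LinearMap.neg_apply, Left.nonneg_neg_iff] at this
  exact le_antisymm this (h1 y hy)

lemma finrank (hF : FacetOf F P) (hP : PolytopeIn l P) :
    Module.finrank ℝ (Submodule.span ℝ F) + 1 = Module.finrank ℝ (Submodule.span ℝ P) := by
  obtain ⟨b, hb⟩ := hF.exists_cuts hP
  obtain ⟨p, hp, -, hbp⟩ := hb.exists_pos hF.ne
  refine le_antisymm (hb.finrank_lt hF.ne) ?_
  have hle : Submodule.span ℝ P ≤ Submodule.span ℝ F ⊔ Submodule.span ℝ {p} := by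
    intro x hx
    have hpP : p ∈ Submodule.span ℝ P := Submodule.subset_span hp
    have h1 : x - (b x / b p) • p ∈ Submodule.span ℝ F := by
      refine hF.mem_span hP hb (Submodule.sub_mem _ hx (Submodule.smul_mem _ _ hpP)) ?_
      simp [hbp.ne']
    rw [← sub_add_cancel x ((b x / b p) • p)]
    exact Submodule.add_mem_sup h1
      (Submodule.smul_mem _ _ (Submodule.mem_span_singleton_self p))
  calc _ ≤ _ := Submodule.finrank_mono hle
    _ ≤ _ := Submodule.finrank_add_le_finrank_add_finrank _ _
    _ ≤ _ := by
      gcongr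
      simpa using finrank_span_le_card (R := ℝ) ({p} : Set V)

/-- Functionals that cut out the same facet are positively proportional. -/
lemma exists_pos_smul (hF : FacetOf F P) (hP : PolytopeIn l P) (ha : Cuts a P F)
    (hb : Cuts b P F) : ∃ t : ℝ, 0 < t ∧ ∀ x ∈ Submodule.span ℝ P, b x = t * a x := by
  obtain ⟨p, hp, hpF, hap⟩ := ha.exists_pos hF.ne
  have hbp := hb.pos hp hpF
  refine ⟨b p / a p, by positivity, fun x hx => ?_⟩
  have hpP : p ∈ Submodule.span ℝ P := Submodule.subset_span hp
  have h1 : x - (a x / a p) • p ∈ Submodule.span ℝ F := by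
    refine hF.mem_span hP ha (Submodule.sub_mem _ hx (Submodule.smul_mem _ _ hpP)) ?_
    simp [hap.ne']
  have h2 := hb.apply_span h1
  simp only [map_sub, map_smul, smul_eq_mul, sub_eq_zero] at h2
  rw [h2]; ring

end FacetOf

namespace PolytopeIn

variable {l : V →ₗ[ℝ] ℝ} {P F G : Set V} {a b c : V →ₗ[ℝ] ℝ}

lemma mem_hull_iff (hP : PolytopeIn l P) {x : V} :
    x ∈ PointedCone.hull ℝ P ↔ x = 0 ∨ ∃ t : ℝ, 0 < t ∧ ∃ p ∈ P, x = t • p := by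
  constructor
  · intro hx
    induction hx using Submodule.span_induction with
    | mem x h => exact Or.inr ⟨1, one_pos, x, h, by simp⟩
    | zero => exact Or.inl rfl
    | add x y hx hy ihx ihy =>
      rcases ihx with rfl | ⟨t, ht, p, hp, rfl⟩
      · simpa using ihy
      · rcases ihy with rfl | ⟨u, hu, q, hq, rfl⟩
        · exact Or.inr ⟨t, ht, p, hp, by simp⟩
        · refine Or.inr ⟨t + u, by positivity, (t / (t + u)) • p + (u / (t + u)) • q, ?_, ?_⟩
          · exact hP.convex hp hq (by positivity) (by positivity) (by field_simp)
          · rw [smul_add, smul_smul, smul_smul, mul_div_cancel₀ _ (by positivity),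
              mul_div_cancel₀ _ (by positivity)]
    | smul a x hx ih =>
      rcases a with ⟨a, ha⟩
      rcases ih with rfl | ⟨t, ht, p, hp, rfl⟩
      · left; simp
      · rcases ha.eq_or_lt with rfl | ha'
        · left
          change (0 : ℝ) • (t • p) = 0
          simp
        · exact Or.inr ⟨a * t, by positivity, p, hp, by rw [mul_smul]; rfl⟩
  · rintro (rfl | ⟨t, ht, p, hp, rfl⟩)
    · exact Submodule.zero_mem _
    · exact PointedCone.smul_mem _ ht.le (Submodule.subset_span hp)

lemma hull_nonneg (hP : PolytopeIn l P) (h : ∀ x ∈ P, 0 ≤ a x) {x : V}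
    (hx : x ∈ PointedCone.hull ℝ P) : 0 ≤ a x := by
  rcases hP.mem_hull_iff.1 hx with rfl | ⟨t, ht, p, hp, rfl⟩
  · simp
  · have := h p hp
    simp only [map_smul, smul_eq_mul]; positivity

lemma coneSection_hull (hP : PolytopeIn l P) : coneSection l (PointedCone.hull ℝ P) = P := by
  ext x
  constructor
  · rintro ⟨hx, hx1⟩
    rcases hP.mem_hull_iff.1 hx with rfl | ⟨t, ht, p, hp, rfl⟩
    · simp at hx1
    · simp only [map_smul, hP.apply_eq_one hp, smul_eq_mul, mul_one] at hx1
      simpa [hx1] using hp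
  · exact fun hx => ⟨Submodule.subset_span hx, hP.apply_eq_one hx⟩

lemma exists_separating (hP : PolytopeIn l P) {x : V} (hx : x ∉ PointedCone.hull ℝ P) :
    ∃ b : V →ₗ[ℝ] ℝ, (∀ y ∈ P, 0 < b y) ∧ b x < 0 := by
  have hx0 : x ≠ 0 := fun h => hx (h ▸ Submodule.zero_mem _)
  -- Separating `P` from the entire ray, not just from `x`, forces the sign of `f x`.
  let R : Set V := (fun t : ℝ => t • x) '' Ici 0
  have hRconv : Convex ℝ R := by
    have := (convex_Ici (0 : ℝ)).linear_image (LinearMap.toSpanSingleton ℝ V x)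
    simpa [R] using this
  have hRclosed : IsClosed R :=
    (isClosedEmbedding_smul_left hx0).isClosedMap _ isClosed_Ici
  have hdisj : Disjoint P R := by
    rw [Set.disjoint_left]
    rintro _ hp ⟨t, ht, rfl⟩
    rcases (mem_Ici.1 ht).eq_or_lt with rfl | ht'
    · simpa using hP.apply_eq_one hp
    · apply hx
      have := PointedCone.smul_mem (PointedCone.hull ℝ P) (inv_nonneg.2 ht'.le)
        (Submodule.subset_span hp)
      simpa [smul_smul, ht'.ne'] using this
  obtain ⟨f, u, v, hu, huv, hv⟩ :=
    geometric_hahn_banach_compact_closed hP.convex hP.isCompact hRconv hRclosed hdisj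
  have hv0 : v < 0 := by simpa using hv 0 ⟨0, by simp, by simp⟩
  have hfx : 0 ≤ f x := by
    by_contra hneg
    push Not at hneg
    have := hv ((v / f x) • x) ⟨v / f x, (div_pos_of_neg_of_neg hv0 hneg).le, rfl⟩
    simp [hneg.ne] at this
  have hcut : Cuts (-(f : V →ₗ[ℝ] ℝ)) P ∅ := by
    refine ⟨fun y hy => ?_, fun y => ?_⟩
    · have := hu y hy
      simp; linarith
    · simp only [mem_empty_iff_false, LinearMap.neg_apply, ContinuousLinearMap.coe_coe, neg_eq_zero,
        false_iff, not_and]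
      intro hy
      have := hu y hy
      linarith
  obtain ⟨g, hgx⟩ : ∃ g : V →ₗ[ℝ] ℝ, g x ≠ 0 := by
    obtain ⟨g, hg, -⟩ := Submodule.exists_le_ker_of_notMem (K := ℝ) (p := ⊥) (v := x) (by simpa)
    exact ⟨g, hg⟩
  -- Separation gives only `f x ≥ 0`. Adding a small multiple of `-(g x) • g` to `-f` makes the
  -- value at `x` strictly negative; positivity on `P` survives because the face cut out is still
  -- `∅`.
  obtain ⟨ε, hε, h⟩ := hP.exists_perturb (c := -(g x) • g) hcut (G := ∅) ⟨by simp, by simp⟩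
  refine ⟨_, fun y hy => h.pos hy (by simp), ?_⟩
  have : 0 < ε * (g x * g x) := mul_pos hε (mul_self_pos.2 hgx)
  simp
  nlinarith

/-- A point of the span of a polytope, positive on all facets, that avoids finitely many
hyperplanes. -/
lemma exists_interior_point (hP : PolytopeIn l P) (T : Finset (V →ₗ[ℝ] ℝ))
    (hT : ∀ f ∈ T, ∃ x ∈ P, f x ≠ 0) :
    ∃ o ∈ Submodule.span ℝ P,
      (∀ (F : Set V) (a : V →ₗ[ℝ] ℝ), F ≠ P → Cuts a P F → 0 < a o) ∧ ∀ f ∈ T, f o ≠ 0 := by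
  classical
  induction T using Finset.induction_on with
  | empty =>
    obtain ⟨s, rfl, hs⟩ := hP
    -- A functional cutting out a proper face is nonnegative at every generator and positive at one
    -- of them, hence positive at their sum.
    refine ⟨∑ x ∈ s, x, Submodule.sum_mem _ fun x hx =>
      Submodule.subset_span (subset_convexHull ℝ _ hx), fun F a hF ha => ?_, by simp⟩
    rw [map_sum]
    refine Finset.sum_pos' (fun x hx => ha.nonneg x (subset_convexHull ℝ _ hx)) ?_
    by_contra hcon
    push Not at hcon
    refine hF (ha.eq_convexHull.trans ?_)
    congr 1
    ext y
    refine ⟨fun h => h.1, fun h => ⟨h, ?_⟩⟩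
    exact le_antisymm (hcon y h) (ha.nonneg y (subset_convexHull ℝ _ h))
  | insert f T hf ih =>
    obtain ⟨o, hoP, hopos, hoT⟩ := ih fun g hg => hT g (Finset.mem_insert_of_mem hg)
    by_cases hfo : f o = 0
    · obtain ⟨z, hz, hfz⟩ := hT f (Finset.mem_insert_self _ _)
      have hev : ∀ᶠ ε in nhdsWithin (0 : ℝ) (Ioi 0), ∀ g ∈ T, g (o + ε • z) ≠ 0 := by
        rw [Filter.eventually_all_finset]
        intro g hg
        have hcont : ContinuousAt (fun ε : ℝ => g (o + ε • z)) 0 := by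
          have : (fun ε : ℝ => g (o + ε • z)) = fun ε => g o + ε * g z := by
            ext ε; simp
          rw [this]; fun_prop
        exact (hcont.eventually_ne (by simpa using hoT g hg)).filter_mono nhdsWithin_le_nhds
      obtain ⟨ε, hε, hεpos⟩ := (hev.and self_mem_nhdsWithin).exists
      have hεpos : 0 < ε := hεpos
      refine ⟨o + ε • z, Submodule.add_mem _ hoP
        (Submodule.smul_mem _ _ (Submodule.subset_span hz)), fun F a hF ha => ?_, fun g hg => ?_⟩
      · have h1 := hopos F a hF ha
        have h2 := ha.nonneg z hz
        simp only [map_add, map_smul, smul_eq_mul]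
        positivity
      · rcases Finset.mem_insert.1 hg with rfl | hg
        · simp [hfo, hεpos.ne', hfz]
        · exact hε g hg
    · refine ⟨o, hoP, hopos, fun g hg => ?_⟩
      rcases Finset.mem_insert.1 hg with rfl | hg
      · exact hfo
      · exact hoT g hg

variable [FiniteDimensional ℝ V]

lemma facetOf_of_finrank (hP : PolytopeIn l P) (ha : Cuts a P F) (hne : F ≠ P)
    (hdim : Module.finrank ℝ (Submodule.span ℝ P) ≤ Module.finrank ℝ (Submodule.span ℝ F) + 1) :
    FacetOf F P := by
  refine hP.facetOf_iff.2 ⟨⟨a, ha⟩, hne, fun b G hb hG hFG => ?_⟩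
  have h1 := hb.finrank_lt hG
  by_contra hGF
  have h2 := (ha.restrict_of_subset hb.subset hFG).finrank_lt (Ne.symm hGF)
  omega

/-- A point of the linear span at which all functionals that cut out facets are positive lies in the
cone spanned by the polytope. -/
lemma mem_hull_of_pos (hP : PolytopeIn l P) {x : V} (hx : x ∈ Submodule.span ℝ P)
    (hpos : ∀ (G : Set V) (a : V →ₗ[ℝ] ℝ), FacetOf G P → Cuts a P G → 0 < a x) :
    x ∈ PointedCone.hull ℝ P := by
  by_contra hxP
  let S : Set (Set V) := {F | ∃ b : V →ₗ[ℝ] ℝ, Cuts b P F ∧ b x < 0}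
  have hS : S.Finite := hP.finite_faces.subset fun F ⟨b, hb, _⟩ => ⟨b, hb⟩
  have hSne : S.Nonempty := by
    obtain ⟨b, hb, hbx⟩ := hP.exists_separating hxP
    refine ⟨∅, b, ⟨fun y hy => (hb y hy).le, fun y => ?_⟩, hbx⟩
    simp only [mem_empty_iff_false, false_iff, not_and]
    exact fun hy => (hb y hy).ne'
  -- A maximal face cut out by a functional negative at `x` must be a facet: otherwise the
  -- functional can be rotated about the span of `F` and `x`, which enlarges the face and keeps the
  -- value at `x`.
  obtain ⟨F, hF⟩ := hS.exists_maximal hSne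
  obtain ⟨b, hb, hbx⟩ := hF.1
  have hne : F ≠ P := by
    rintro rfl
    exact hbx.ne (hb.apply_span hx)
  by_cases hle : P ⊆ (Submodule.span ℝ F ⊔ Submodule.span ℝ {x} : Submodule ℝ V)
  · refine absurd (hpos F b (hP.facetOf_of_finrank hb hne ?_) hb) (not_lt.2 hbx.le)
    calc _ ≤ _ := Submodule.finrank_mono (Submodule.span_le.2 hle)
      _ ≤ _ := Submodule.finrank_add_le_finrank_add_finrank _ _
      _ ≤ _ := by
        gcongr
        simpa using finrank_span_le_card (R := ℝ) ({x} : Set V)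
  · obtain ⟨p, hp, hpn⟩ := Set.not_subset.1 hle
    obtain ⟨c, hcp, hc⟩ := Submodule.exists_le_ker_of_notMem hpn
    have hcF : ∀ y ∈ F, c y = 0 := fun y hy =>
      hc (Submodule.mem_sup_left (Submodule.subset_span hy))
    have hcx : c x = 0 := hc (Submodule.mem_sup_right (Submodule.mem_span_singleton_self x))
    obtain ⟨t, -, F', hF', hFF'⟩ := hP.exists_pencil (c := -(c p) • c) hb
      (fun y hy => by simp [hcF y hy])
      ⟨p, hp, by simpa using mul_self_pos.2 hcp⟩
    refine hFF'.not_subset (hF.2 ⟨_, hF', ?_⟩ hFF'.subset)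
    simpa [hcx] using hbx

/-- A facet of a facet of `P` is the intersection of that facet with another one. -/
lemma exists_facet_inter (hP : PolytopeIn l P) (hF : FacetOf F P) (hG : FacetOf G F) :
    ∃ F', FacetOf F' P ∧ F' ≠ F ∧ F ∩ F' = G := by
  obtain ⟨a, ha⟩ := hF.exists_cuts hP
  have hFp := hF.polytopeIn hP
  obtain ⟨c, hc⟩ := hG.exists_cuts hFp
  obtain ⟨b, hb⟩ := hP.cuts_trans ha hc
  obtain ⟨p, hp, -, hap⟩ := ha.exists_pos hF.ne
  -- As `a` vanishes on `F`, rotating `b` towards `-a` does not change it on `F`. The larger face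
  -- `E` therefore meets `F` only in `G`, and no facet containing `E` can be `F`.
  obtain ⟨t, ht, E, hE, hGE⟩ := hP.exists_pencil (c := -a) hb
    (fun y hy => by simp [ha.eq_zero (hG.subset hy)]) ⟨p, hp, by simpa using hap⟩
  have hEF : ∀ x, x ∈ E → x ∈ F → x ∈ G := by
    intro x hxE hxF
    refine (hb.mem_iff x).2 ⟨ha.subset hxF, ?_⟩
    simpa [ha.eq_zero hxF] using hE.eq_zero hxE
  have hEP : E ≠ P := by
    rintro rfl
    exact hG.ne (Subset.antisymm hG.subset fun x hx => hEF x (hF.subset hx) hx)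
  obtain ⟨F', hF', hEF'⟩ := hP.exists_facet hE hEP
  have hne : F' ≠ F := by
    rintro rfl
    exact hGE.not_subset fun x hx => hEF x hx (hEF' hx)
  refine ⟨F', hF', hne, ?_⟩
  obtain ⟨a', ha'⟩ := hF'.exists_cuts hP
  have hcut := ha'.restrict hF.subset
  rw [inter_comm]
  refine (hFp.facetOf_iff.1 hG).2.2 _ _ hcut ?_
    fun x hx => ⟨hEF' (hGE.subset hx), hG.subset hx⟩
  intro heq
  exact hne (hF.eq_of_subset hF' (inter_eq_right.1 heq)).symm

end PolytopeIn

end Facets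

/-! ### Lists sorted by a real-valued key. -/

section ListLemmas

variable {α : Type*}

lemma exists_list_pairwise_lt {S : Set α} (hS : S.Finite) {κ : α → ℝ} (hκ : InjOn κ S) :
    ∃ L : List α, L.Nodup ∧ (∀ x, x ∈ L ↔ x ∈ S) ∧ L.Pairwise (fun x y => κ x < κ y) := by
  classical
  let L := hS.toFinset.toList.mergeSort (fun x y => decide (κ x ≤ κ y))
  have hperm : L.Perm hS.toFinset.toList := List.mergeSort_perm _ _
  have hnd : L.Nodup := hperm.nodup_iff.2 (Finset.nodup_toList _)
  have hmem : ∀ x, x ∈ L ↔ x ∈ S := fun x => by simp [hperm.mem_iff]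
  have hle : L.Pairwise (fun x y => decide (κ x ≤ κ y) = true) := by
    apply List.pairwise_mergeSort
    · intro x y z; simpa using le_trans
    · intro x y; simpa using le_total _ _
  refine ⟨L, hnd, hmem, ?_⟩
  refine (hle.and hnd).imp_of_mem ?_
  rintro x y hx hy ⟨h1, h2⟩
  refine lt_of_le_of_ne (by simpa using h1) fun h => h2 ?_
  exact hκ ((hmem x).1 hx) ((hmem y).1 hy) h

/-- Used to turn visibility, a sign condition on the key, into an initial segment. -/
lemma List.Pairwise.exists_mem_take_iff {κ : α → ℝ} {L : List α}
    (hL : L.Pairwise (fun x y => κ x < κ y)) (t : ℝ) :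
    ∃ r ≤ L.length, ∀ x, x ∈ L.take r ↔ x ∈ L ∧ κ x < t := by
  induction L with
  | nil => exact ⟨0, by simp, by simp⟩
  | cons y L ih =>
    rw [List.pairwise_cons] at hL
    by_cases hy : κ y < t
    · obtain ⟨r, hr, h⟩ := ih hL.2
      refine ⟨r + 1, by simpa using hr, fun x => ?_⟩
      simp only [List.take_succ_cons, List.mem_cons, h]
      constructor
      · rintro (rfl | h)
        · exact ⟨Or.inl rfl, hy⟩
        · exact ⟨Or.inr h.1, h.2⟩
      · rintro ⟨rfl | h, h'⟩
        · exact Or.inl rfl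
        · exact Or.inr ⟨h, h'⟩
    · refine ⟨0, by simp, fun x => ?_⟩
      simp only [List.take_zero, List.not_mem_nil, List.mem_cons, false_iff, not_and, not_lt]
      rintro (rfl | h)
      · exact not_lt.1 hy
      · exact (not_lt.1 hy).trans (hL.1 x h).le

lemma List.Pairwise.mem_take_iff {κ : α → ℝ} {L : List α}
    (hL : L.Pairwise (fun x y => κ x < κ y)) (j : Fin L.length) (x : α) :
    x ∈ L.take j ↔ x ∈ L ∧ κ x < κ (L.get j) := by
  rw [List.pairwise_iff_get] at hL
  constructor
  · intro hx
    obtain ⟨i, hi, rfl⟩ := List.mem_take_iff_getElem.1 hx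
    have hi' : i < (j : ℕ) := lt_of_lt_of_le hi (min_le_left _ _)
    refine ⟨List.getElem_mem _, ?_⟩
    exact hL ⟨i, hi'.trans j.2⟩ j hi'
  · rintro ⟨hx, hlt⟩
    obtain ⟨i, rfl⟩ := List.get_of_mem hx
    have hij : i < j := by
      by_contra hcon
      rcases (not_lt.1 hcon).eq_or_lt with rfl | h
      · exact lt_irrefl _ hlt
      · exact absurd (hL j i h) (not_lt.2 hlt.le)
    exact List.mem_take_iff_getElem.2 ⟨i, lt_min hij i.2, rfl⟩

end ListLemmas

/-! ### Line shellings of boundary complexes. -/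

section LineShelling

variable {V : Type*} [NormedAddCommGroup V] [NormedSpace ℝ V] [FiniteDimensional ℝ V]
  {l : V →ₗ[ℝ] ℝ}

/-- If the direction `c` leaves the cone spanned by `P` at the point `y`, then `y` lies on a facet
whose functional is negative at `c`. -/
lemma PolytopeIn.exists_facet_neg {P : Set V} (hP : PolytopeIn l P) {c y : V}
    (hc : c ∈ Submodule.span ℝ P) (hy : y ∈ P)
    (hgen : ∀ (G : Set V) (a : V →ₗ[ℝ] ℝ), FacetOf G P → Cuts a P G → a c ≠ 0)
    (hout : ∀ ε : ℝ, 0 < ε → y + ε • c ∉ PointedCone.hull ℝ P) :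
    ∃ (G : Set V) (a : V →ₗ[ℝ] ℝ), FacetOf G P ∧ Cuts a P G ∧ y ∈ G ∧ a c < 0 := by
  by_contra hcon
  push Not at hcon
  -- If `c` were positive on every facet through `y`, then `y + ε • c` would be positive on all
  -- facets for small `ε`, hence inside the cone.
  choose! A hA using fun (G : Set V) (hG : FacetOf G P) => hG.exists_cuts hP
  have hev : ∀ᶠ ε in nhdsWithin (0 : ℝ) (Ioi 0), ∀ G ∈ hP.finite_facets.toFinset,
      0 < A G (y + ε • c) := by
    rw [Filter.eventually_all_finset]
    intro G hG
    have hG : FacetOf G P := by simpa using hG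
    by_cases hyG : y ∈ G
    · filter_upwards [self_mem_nhdsWithin] with ε hε
      have h1 := lt_of_le_of_ne (hcon G _ hG (hA G hG) hyG) (hgen G _ hG (hA G hG)).symm
      have hε : 0 < ε := hε
      simp only [map_add, map_smul, smul_eq_mul, (hA G hG).eq_zero hyG]
      positivity
    · have hcont : ContinuousAt (fun ε : ℝ => A G (y + ε • c)) 0 := by
        have : (fun ε : ℝ => A G (y + ε • c)) = fun ε => A G y + ε * A G c := by
          ext ε; simp
        rw [this]; fun_prop
      refine (hcont.eventually (lt_mem_nhds ?_)).filter_mono nhdsWithin_le_nhds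
      simpa using (hA G hG).pos hy hyG
  obtain ⟨ε, hε, hεpos⟩ := (hev.and self_mem_nhdsWithin).exists
  have hspan : y + ε • c ∈ Submodule.span ℝ P :=
    Submodule.add_mem _ (Submodule.subset_span hy) (Submodule.smul_mem _ _ hc)
  refine hout ε hεpos (hP.mem_hull_of_pos hspan fun G a hG ha => ?_)
  obtain ⟨t, ht, h⟩ := hG.exists_pos_smul hP (hA G hG) ha
  rw [h _ hspan]
  exact mul_pos ht (hε G (by simpa using hG))

/-- Line shellings: the boundary complex of a polytope has a shelling that begins with the facets
visible from a given point in general position. -/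
theorem PolytopeIn.exists_line_shelling {P : Set V} (hP : PolytopeIn l P) {c : V}
    (hc : c ∈ Submodule.span ℝ P)
    (hgen : ∀ (G : Set V) (a : V →ₗ[ℝ] ℝ), FacetOf G P → Cuts a P G → a c ≠ 0) :
    ∃ L : List (Set V), IsShelling (boundaryComplex P) L ∧ ∃ r ≤ L.length,
      ∀ G, G ∈ L.take r ↔ FacetOf G P ∧ ∀ a : V →ₗ[ℝ] ℝ, Cuts a P G → a c < 0 := by
  classical
  induction hn : Module.finrank ℝ (Submodule.span ℝ P) using Nat.strong_induction_on
    generalizing P c with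
  | _ n ih =>
  choose! A hA using fun (G : Set V) (hG : FacetOf G P) => hG.exists_cuts hP
  -- If none of these functionals vanishes at `o`, distinct facets have distinct ratios `A G c / A G
  -- o`.
  let T : Finset (V →ₗ[ℝ] ℝ) :=
    ((hP.finite_facets.toFinset ×ˢ hP.finite_facets.toFinset).filter (fun p => p.1 ≠ p.2)).image
      (fun p => A p.1 c • A p.2 - A p.2 c • A p.1)
  have hT : ∀ f ∈ T, ∃ x ∈ P, f x ≠ 0 := by
    intro f hf
    simp only [T, Finset.mem_image, Finset.mem_filter, Finset.mem_product, Set.Finite.mem_toFinset,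
      mem_ofPred_eq, Prod.exists] at hf
    obtain ⟨G, H, ⟨⟨hG, hH⟩, hGH⟩, rfl⟩ := hf
    by_contra hcon
    push Not at hcon
    refine hGH (hG.eq_of_subset hH fun x hx => ((hA H hH).mem_iff x).2 ⟨hG.subset hx, ?_⟩)
    have h1 := hcon x (hG.subset hx)
    simpa [(hA G hG).eq_zero hx, hgen G _ hG (hA G hG)] using h1
  obtain ⟨o, hoP, hopos, hoT⟩ := hP.exists_interior_point T hT
  have hAo : ∀ G, FacetOf G P → 0 < A G o := fun G hG => hopos G _ hG.ne (hA G hG)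
  let κ : Set V → ℝ := fun G => A G c / A G o
  have hκ : InjOn κ {F | FacetOf F P} := by
    intro G hG H hH hGH
    by_contra hne
    refine hoT (A G c • A H - A H c • A G) ?_ ?_
    · exact Finset.mem_image.2 ⟨(G, H), by simp [hG.out, hH.out, hne], rfl⟩
    · have h1 := (hAo G hG).ne'
      have h2 := (hAo H hH).ne'
      simp only [κ, div_eq_div_iff h1 h2] at hGH
      simp [hGH]
  obtain ⟨L, hnd, hmem, hsort⟩ := exists_list_pairwise_lt hP.finite_facets hκ
  have hmem : ∀ F, F ∈ L ↔ FacetOf F P := hmem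
  -- The point where the line through `c` in direction `o` crosses the span of `F`; it serves as the
  -- viewpoint for `F` in the induction.
  let cf : Set V → V := fun F => c - κ F • o
  have hAcf : ∀ F H, FacetOf H P → A H (cf F) = A H o * (κ H - κ F) := by
    intro F H hH
    have := (hAo H hH).ne'
    simp only [cf, κ, map_sub, map_smul, smul_eq_mul]
    field_simp
  have hcf : ∀ F, FacetOf F P → cf F ∈ Submodule.span ℝ F := by
    intro F hF
    refine hF.mem_span hP (hA F hF) (Submodule.sub_mem _ hc (Submodule.smul_mem _ _ hoP)) ?_
    simp [hAcf F F hF]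
  -- A functional cutting out `F ∩ H` in `F` is a positive multiple of `A H` on the span of `F`, so
  -- its sign at `cf F` tells whether `H` comes before `F`.
  have hsign : ∀ F G, FacetOf F P → FacetOf G F → ∃ H, FacetOf H P ∧ H ≠ F ∧ F ∩ H = G ∧
      ∀ a : V →ₗ[ℝ] ℝ, Cuts a F G → ∃ t : ℝ, 0 < t ∧ a (cf F) = t * (κ H - κ F) := by
    intro F G hF hG
    obtain ⟨H, hH, hne, hFH⟩ := hP.exists_facet_inter hF hG
    refine ⟨H, hH, hne, hFH, fun a ha => ?_⟩
    have hcut := (hA H hH).restrict hF.subset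
    rw [inter_comm, hFH] at hcut
    obtain ⟨t, ht, h⟩ := hG.exists_pos_smul (hF.polytopeIn hP) hcut ha
    refine ⟨t * A H o, mul_pos ht (hAo H hH), ?_⟩
    rw [h _ (hcf F hF), hAcf F H hH, mul_assoc]
  have hgenF : ∀ F, FacetOf F P → ∀ (G : Set V) (a : V →ₗ[ℝ] ℝ), FacetOf G F → Cuts a F G →
      a (cf F) ≠ 0 := by
    intro F hF G a hG ha
    obtain ⟨H, hH, hne, -, h⟩ := hsign F G hF hG
    obtain ⟨t, ht, hat⟩ := h a ha
    rw [hat]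
    exact mul_ne_zero ht.ne' (sub_ne_zero.2 fun h => hne (hκ hH hF h))
  have hM : ∀ F, FacetOf F P → ∃ M : List (Set V), IsShelling (boundaryComplex F) M ∧
      ∃ r ≤ M.length, ∀ G, G ∈ M.take r ↔
        FacetOf G F ∧ ∀ a : V →ₗ[ℝ] ℝ, Cuts a F G → a (cf F) < 0 := by
    intro F hF
    refine ih _ ?_ (hF.polytopeIn hP) (hcf F hF) (hgenF F hF) rfl
    rw [← hn, ← hF.finrank hP]
    exact Nat.lt_succ_self _
  choose! M hMsh r hr hrmem using hM
  have hneg : ∀ F G, FacetOf F P → FacetOf G F → ∀ a : V →ₗ[ℝ] ℝ, Cuts a F G → a (cf F) < 0 →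
      G ∈ (M F).take (r F) := by
    intro F G hF hG a ha hlt
    refine (hrmem F hF G).2 ⟨hG, fun b hb => ?_⟩
    obtain ⟨t, ht, h⟩ := hG.exists_pos_smul (hF.polytopeIn hP) ha hb
    rw [h _ (hcf F hF)]
    exact mul_neg_of_pos_of_neg ht hlt
  have hget : ∀ j : Fin L.length, FacetOf (L.get j) P := fun j => (hmem _).1 (L.get_mem j)
  refine ⟨L, IsShelling.step _ L ⟨hnd, hmem⟩ (fun j => M (L.get j)) (fun j => hMsh _ (hget j))
    fun j hj => ⟨r (L.get j), ?_, hr _ (hget j), ?_⟩, ?_⟩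
  · have hF := hget j
    set F := L.get j
    have hFp := hF.polytopeIn hP
    have h0 : 0 < L.length := j.pos
    have hlt : κ (L.get ⟨0, h0⟩) < κ F := List.pairwise_iff_get.1 hsort _ _ hj
    have hK := hget ⟨0, h0⟩
    -- The first facet of the list is negative at `cf F`. Thus `cf F` lies outside the cone over `F`
    -- and some facet of `F` is visible from it, which gives `1 ≤ r`.
    have hcon : cf F ∉ PointedCone.hull ℝ F := by
      intro hcon
      have h1 := hP.hull_nonneg (hA _ hK).nonneg (Submodule.span_mono hF.subset hcon)
      rw [hAcf _ _ hK] at h1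
      have := hAo _ hK
      nlinarith
    have : ∃ (G : Set V) (a : V →ₗ[ℝ] ℝ), FacetOf G F ∧ Cuts a F G ∧ a (cf F) ≤ 0 := by
      by_contra hno
      push Not at hno
      exact hcon (hFp.mem_hull_of_pos (hcf F hF) hno)
    obtain ⟨G, a, hG, ha, hle⟩ := this
    have h1 := hneg F G hF hG a ha (lt_of_le_of_ne hle (hgenF F hF G a hG ha))
    by_contra hr0
    simp [Nat.lt_one_iff.1 (not_le.1 hr0)] at h1
  · have hF := hget j
    have htake := hsort.mem_take_iff j
    set F := L.get j
    have hFp := hF.polytopeIn hP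
    ext y
    simp only [mem_inter_iff, mem_iUnion, exists_prop]
    constructor
    · rintro ⟨hyF, K, hK, hyK⟩
      obtain ⟨hKL, hKlt⟩ := (htake K).1 hK
      have hK := (hmem K).1 hKL
      -- `A K` is zero at `y` and negative at `cf F`, so every step from `y` in direction `cf F`
      -- leaves the cone.
      obtain ⟨G, a, hG, ha, hyG, hlt⟩ := hFp.exists_facet_neg (hcf F hF) hyF (hgenF F hF) (by
        intro ε hε hmem
        have h1 := hP.hull_nonneg (hA _ hK).nonneg (Submodule.span_mono hF.subset hmem)
        rw [map_add, map_smul, (hA K hK).eq_zero hyK, hAcf _ _ hK, zero_add, smul_eq_mul] at h1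
        have h2 := hAo _ hK
        have h3 : 0 < ε * (A K o * (κ F - κ K)) :=
          mul_pos hε (mul_pos h2 (sub_pos.2 hKlt))
        nlinarith)
      exact ⟨G, hneg F G hF hG a ha hlt, hyG⟩
    · rintro ⟨G, hG, hyG⟩
      obtain ⟨hGF, hGneg⟩ := (hrmem F hF G).1 hG
      obtain ⟨H, hH, hne, hFH, h⟩ := hsign F G hF hGF
      obtain ⟨a, ha⟩ := hGF.exists_cuts hFp
      obtain ⟨t, ht, hat⟩ := h a ha
      have hlt := hGneg a ha
      rw [hat] at hlt
      have hκlt : κ H < κ F := by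
        by_contra hcon
        have := mul_nonneg ht.le (sub_nonneg.2 (not_lt.1 hcon))
        linarith
      rw [← hFH] at hyG
      exact ⟨hyG.1, H, (htake H).2 ⟨(hmem H).2 hH, hκlt⟩, hyG.2⟩
  -- Since `A G o > 0`, the facet `G` is visible from `c` exactly when `κ G < 0`.
  · obtain ⟨s, hs, hsmem⟩ := hsort.exists_mem_take_iff 0
    refine ⟨s, hs, fun G => ?_⟩
    rw [hsmem, hmem]
    refine and_congr_right fun hG => ?_
    have hpos := hAo G hG
    constructor
    · intro hlt a ha
      obtain ⟨t, ht, h⟩ := hG.exists_pos_smul hP (hA G hG) ha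
      rw [h c hc]
      refine mul_neg_of_pos_of_neg ht ?_
      simp only [κ] at hlt
      rwa [div_lt_iff₀ hpos, zero_mul] at hlt
    · intro h
      exact div_neg_of_neg_of_pos (h _ (hA G hG)) hpos

theorem PolytopeIn.exists_shelling {P : Set V} (hP : PolytopeIn l P) :
    ∃ L : List (Set V), IsShelling (boundaryComplex P) L := by
  obtain ⟨o, hoP, ho, -⟩ := hP.exists_interior_point ∅ (by simp)
  obtain ⟨L, hL, -⟩ := hP.exists_line_shelling hoP fun G a hG ha => (ho G a hG.ne ha).ne'
  exact ⟨L, hL⟩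

end LineShelling

/-! ### Facet chains and the recursive choice of shellings. -/

section Chains

variable {V : Type*}

lemma precedes_append_cons_iff {p s : List (Set V)} {F K : Set V} (h : (p ++ F :: s).Nodup) :
    Precedes (p ++ F :: s) K F ↔ K ∈ p := by
  unfold Precedes
  induction p with
  | nil =>
    simp only [List.nil_append, List.nodup_cons, List.not_mem_nil, iff_false] at h ⊢
    intro hsub
    cases hsub with
    | cons _ h' => exact h.1 (h'.subset (by simp))
    | cons_cons _ h' => exact h.1 (h'.subset (by simp))
  | cons y p ih =>
    simp only [List.cons_append, List.nodup_cons, List.mem_cons] at h ⊢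
    constructor
    · intro hsub
      cases hsub with
      | cons _ h' => exact Or.inr ((ih h.2).1 h')
      | cons_cons _ h' => exact Or.inl rfl
    · rintro (rfl | hK)
      · exact List.Sublist.cons_cons _ (List.singleton_sublist.2 (by simp))
      · exact List.Sublist.cons _ ((ih h.2).2 hK)

lemma precedes_get_iff {L : List (Set V)} (h : L.Nodup) (j : Fin L.length) {K : Set V} :
    Precedes L K (L.get j) ↔ K ∈ L.take j := by
  have hL : L = L.take j ++ L.get j :: L.drop (j + 1) := by
    rw [List.get_eq_getElem, ← List.drop_eq_getElem_cons j.2, List.take_append_drop]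
  have h' := h
  rw [hL] at h'
  have := precedes_append_cons_iff (K := K) h'
  rwa [← hL] at this

lemma Precedes.mem_left {L : List (Set V)} {F G : Set V} (h : Precedes L F G) : F ∈ L :=
  List.Sublist.subset h (by simp)

lemma Precedes.mem_right {L : List (Set V)} {F G : Set V} (h : Precedes L F G) : G ∈ L :=
  List.Sublist.subset h (by simp)

lemma Precedes.ne {L : List (Set V)} (hL : L.Nodup) {F G : Set V} (h : Precedes L F G) : F ≠ G := by
  have := List.Nodup.sublist h hL
  simpa using this

lemma Precedes.asymm {L : List (Set V)} {F G : Set V} (h : Precedes L F G) (hL : L.Nodup) :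
    ¬ Precedes L G F := by
  intro h'
  obtain ⟨p, s, rfl⟩ := List.append_of_mem h.mem_right
  have hF := (precedes_append_cons_iff hL).1 h
  obtain ⟨p, q, rfl⟩ := List.append_of_mem hF
  rw [List.append_assoc, List.cons_append] at h' hL
  have hG := (precedes_append_cons_iff hL).1 h'
  exact (List.nodup_append.1 hL).2.2 G hG G (by simp) rfl

lemma precedes_of_mem_take {L : List (Set V)} (hL : L.Nodup) {r : ℕ} {H F : Set V}
    (hH : H ∈ L.take r) (hF : F ∈ L) (hFr : F ∉ L.take r) : Precedes L H F := by
  obtain ⟨j, rfl⟩ := List.get_of_mem hF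
  rw [precedes_get_iff hL]
  have hj : r ≤ j := by
    by_contra hcon
    exact hFr (List.mem_take_iff_getElem.2 ⟨j, lt_min (not_le.1 hcon) j.2, rfl⟩)
  exact (List.take_subset_take_left _ hj) hH

variable [NormedAddCommGroup V] [NormedSpace ℝ V]

lemma IsShelling.isFacetOrdering {C : Set (Set V)} {L : List (Set V)} (h : IsShelling C L) :
    IsFacetOrdering C L := by
  cases h with
  | points _ _ hL _ => exact hL
  | step _ _ hL _ _ _ => exact hL

/-- The recursive structure of a shelling of a boundary complex. -/
lemma IsShelling.exists_next {G F : Set V} {L : List (Set V)} (h : IsShelling (boundaryComplex G) L)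
    (hF : F ∈ L) (hFn : F.Nontrivial) :
    ∃ N, IsShelling (boundaryComplex F) N ∧ ∃ r ≤ N.length,
      F ∩ (⋃ K ∈ {K | Precedes L K F}, K) = (⋃ H ∈ N.take r, H) ∧
      ((∃ K, Precedes L K F) → 1 ≤ r) := by
  cases h with
  | points _ _ hL hC => exact absurd hFn (not_nontrivial_iff.2 (hC F ((hL.2 F).1 hF).1))
  | step _ _ hL M hM hinter =>
    obtain ⟨j, rfl⟩ := List.get_of_mem hF
    refine ⟨M j, hM j, ?_⟩
    simp only [precedes_get_iff hL.1, mem_ofPred_eq]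
    rcases Nat.eq_zero_or_pos (j : ℕ) with hj | hj
    -- Nothing precedes the first facet, so the empty segment fits whichever shelling of its
    -- boundary is given.
    · exact ⟨0, by simp, by simp [hj]⟩
    · obtain ⟨r, h1, h2, h3⟩ := hinter j hj
      exact ⟨r, h2, h3, fun _ => h1⟩

open Classical in
/-- A recursive choice of shellings, along a chain listed from the bottom to the top. -/
noncomputable def recursiveShellingAux : List (Set V) → List (Set V)
  | [] => []
  | [F] => if h : ∃ L, IsShelling (boundaryComplex F) L then h.choose else []
  | F :: G :: c =>
    if h : ∃ N, IsShelling (boundaryComplex F) N ∧ ∃ r ≤ N.length,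
      F ∩ (⋃ K ∈ {K | Precedes (recursiveShellingAux (G :: c)) K F}, K) = (⋃ H ∈ N.take r, H)
    then h.choose else []

lemma isFacetChain_singleton {P F : Set V} : IsFacetChain P [F] ↔ F = P := by
  simp [IsFacetChain]

lemma isFacetChain_append_pair {P G F : Set V} {p : List (Set V)} :
    IsFacetChain P (p ++ [G, F]) ↔ IsFacetChain P (p ++ [G]) ∧ FacetOf F G := by
  have h : p ++ [G, F] = (p ++ [G]) ++ [F] := by simp
  rw [h, IsFacetChain, IsFacetChain, List.isChain_append, List.head?_append]
  simp [FacetOf, and_assoc]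

lemma IsFacetChain.prefix {P : Set V} {c t : List (Set V)} (h : IsFacetChain P (c ++ t))
    (hc : c ≠ []) : IsFacetChain P c := by
  obtain ⟨h1, h2⟩ := h
  refine ⟨?_, (List.isChain_append.1 h2).1⟩
  cases c with
  | nil => exact absurd rfl hc
  | cons a c => simpa using h1

lemma IsFacetChain.facetOf {P : Set V} {p s : List (Set V)} {G F : Set V}
    (h : IsFacetChain P (p ++ G :: F :: s)) : FacetOf F G := by
  have := h.2
  rw [List.isChain_append] at this
  exact (List.isChain_cons_cons.1 this.2.1).1

/-- Members of a facet chain decrease. -/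
lemma IsFacetChain.pairwise {P : Set V} {c : List (Set V)} (h : IsFacetChain P c) :
    c.Pairwise (fun G F => F ⊂ G) := by
  refine List.isChain_iff_pairwise.1 (h.2.imp fun G F hF => ?_)
  have hF : FacetOf F G := hF
  exact hF.subset.ssubset_of_ne hF.ne

lemma IsFacetChain.nodup {P : Set V} {c : List (Set V)} (h : IsFacetChain P c) : c.Nodup :=
  h.pairwise.imp fun h => h.ne'

variable [FiniteDimensional ℝ V] {l : V →ₗ[ℝ] ℝ} {P : Set V}

lemma IsFacetChain.exists_cuts (hP : PolytopeIn l P) {c : List (Set V)} (h : IsFacetChain P c)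
    {F : Set V} (hF : F ∈ c) : ∃ a : V →ₗ[ℝ] ℝ, Cuts a P F := by
  induction c using List.reverseRecOn generalizing F with
  | nil => simp at hF
  | append_singleton c G ih =>
    rcases List.eq_nil_or_concat' c with rfl | ⟨p, Q, rfl⟩
    · rw [List.nil_append, isFacetChain_singleton] at h
      simp only [List.nil_append, List.mem_singleton] at hF
      rw [hF, h]
      exact ⟨0, Cuts.self P⟩
    · rw [List.append_assoc, List.singleton_append, isFacetChain_append_pair] at h
      rcases List.mem_append.1 hF with hF | hF
      · exact ih h.1 hF
      · obtain ⟨a, ha⟩ := ih h.1 (F := Q) (by simp)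
        obtain ⟨b, hb⟩ := h.2.exists_cuts (hP.of_cuts ha)
        rw [List.mem_singleton.1 hF]
        exact hP.cuts_trans ha hb

lemma IsFacetChain.polytopeIn (hP : PolytopeIn l P) {c : List (Set V)} (h : IsFacetChain P c)
    {F : Set V} (hF : F ∈ c) : PolytopeIn l F :=
  let ⟨_, ha⟩ := h.exists_cuts hP hF
  hP.of_cuts ha

/-- Only the top shelling has to be constructed. Below it, the shelling chosen for `G` contains, by
definition, a suitable shelling of the boundary of each of its facets `F`. -/
theorem exists_isRecursiveShelling (hP : PolytopeIn l P) : ∃ ord, IsRecursiveShelling P ord := by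
  have key : ∀ (p : List (Set V)) (G F : Set V), IsFacetChain P (p ++ [G, F]) → F.Nontrivial →
      IsShelling (boundaryComplex G) (recursiveShellingAux (p ++ [G]).reverse) →
      ∃ N, IsShelling (boundaryComplex F) N ∧ ∃ r ≤ N.length,
        F ∩ (⋃ K ∈ {K | Precedes (recursiveShellingAux (G :: p.reverse)) K F}, K) =
          (⋃ H ∈ N.take r, H) := by
    intro p G F hc hF hG
    rw [isFacetChain_append_pair] at hc
    rw [List.reverse_append, List.reverse_singleton, List.singleton_append] at hG
    obtain ⟨N, hN, r, hr, h1, -⟩ := hG.exists_next ((hG.isFacetOrdering.2 F).2 hc.2) hF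
    exact ⟨N, hN, r, hr, h1⟩
  have hsh : ∀ (p : List (Set V)) (F : Set V), IsFacetChain P (p ++ [F]) → F.Nontrivial →
      IsShelling (boundaryComplex F) (recursiveShellingAux (p ++ [F]).reverse) := by
    intro p
    induction p using List.reverseRecOn with
    | nil =>
      intro F hF _
      rw [List.nil_append, isFacetChain_singleton] at hF
      subst hF
      have h := hP.exists_shelling
      simp only [List.nil_append, List.reverse_singleton, recursiveShellingAux, dif_pos h]
      exact h.choose_spec
    | append_singleton p G ih =>
      intro F hc hF
      rw [List.append_assoc, List.singleton_append] at hc ⊢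
      have hc' := isFacetChain_append_pair.1 hc
      have h := key p G F hc hF (ih G hc'.1 (hF.mono hc'.2.subset))
      simp only [List.reverse_append, List.reverse_cons, List.reverse_nil, List.nil_append,
        List.cons_append, recursiveShellingAux, dif_pos h]
      exact h.choose_spec.1
  refine ⟨fun c => recursiveShellingAux c.reverse, hsh, ?_⟩
  intro p G F hc hF
  have hc' := isFacetChain_append_pair.1 hc
  have h := key p G F hc hF (hsh p G hc'.1 (hF.mono hc'.2.subset))
  simp only [List.reverse_append, List.reverse_cons, List.reverse_nil, List.nil_append,
    List.cons_append, recursiveShellingAux, dif_pos h]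
  exact h.choose_spec.2

end Chains

/-! ### Rank of the linear span, and relative interior points. -/

section Dimension

variable {V : Type*} [NormedAddCommGroup V] [NormedSpace ℝ V]
  {l : V →ₗ[ℝ] ℝ} {P : Set V}

namespace PolytopeIn

lemma ne_zero_of_mem (hP : PolytopeIn l P) {x : V} (hx : x ∈ P) : x ≠ 0 := by
  rintro rfl
  simpa using hP.apply_eq_one hx

variable [FiniteDimensional ℝ V]

lemma finrank_pos_iff (hP : PolytopeIn l P) :
    0 < Module.finrank ℝ (Submodule.span ℝ P) ↔ P.Nonempty := by
  constructor
  · intro h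
    by_contra hne
    obtain rfl := not_nonempty_iff_eq_empty.1 hne
    rw [Submodule.span_empty, finrank_bot] at h
    exact lt_irrefl _ h
  · rintro ⟨x, hx⟩
    rw [Module.finrank_pos_iff_exists_ne_zero]
    exact ⟨⟨x, Submodule.subset_span hx⟩, fun h => hP.ne_zero_of_mem hx (congrArg Subtype.val h)⟩

lemma finrank_eq_one_iff (hP : PolytopeIn l P) :
    Module.finrank ℝ (Submodule.span ℝ P) = 1 ↔ ∃ v, P = {v} := by
  constructor
  · intro h
    obtain ⟨x, hx⟩ := hP.finrank_pos_iff.1 (by omega)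
    refine ⟨x, Subset.antisymm (fun y hy => ?_) (singleton_subset_iff.2 hx)⟩
    have hx0 : (⟨x, Submodule.subset_span hx⟩ : Submodule.span ℝ P) ≠ 0 :=
      fun h => hP.ne_zero_of_mem hx (congrArg Subtype.val h)
    obtain ⟨c, hc⟩ := exists_smul_eq_of_finrank_eq_one h hx0 ⟨y, Submodule.subset_span hy⟩
    have hc : c • x = y := congrArg Subtype.val hc
    have h1 := hP.apply_eq_one hy
    rw [← hc, map_smul, hP.apply_eq_one hx, smul_eq_mul, mul_one] at h1
    rw [← hc, h1, one_smul]; rfl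
  · rintro ⟨v, rfl⟩
    exact finrank_span_singleton (hP.ne_zero_of_mem (mem_singleton v))

lemma nontrivial_iff (hP : PolytopeIn l P) :
    P.Nontrivial ↔ 2 ≤ Module.finrank ℝ (Submodule.span ℝ P) := by
  constructor
  · intro h
    have h0 := hP.finrank_pos_iff.2 h.nonempty
    have h1 : Module.finrank ℝ (Submodule.span ℝ P) ≠ 1 := by
      rw [Ne, hP.finrank_eq_one_iff]
      rintro ⟨v, rfl⟩
      simp at h
    omega
  · intro h
    rw [← not_subsingleton_iff]
    intro hs
    rcases hs.eq_empty_or_singleton with rfl | ⟨v, rfl⟩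
    · rw [Submodule.span_empty, finrank_bot] at h
      omega
    · have := hP.finrank_eq_one_iff.2 ⟨v, rfl⟩
      omega

/-- A nonempty polytope has a point that lies on none of its proper faces. -/
lemma exists_relint (hP : PolytopeIn l P) (hne : P.Nonempty) :
    ∃ p ∈ P, ∀ (F : Set V) (a : V →ₗ[ℝ] ℝ), F ≠ P → Cuts a P F → 0 < a p := by
  obtain ⟨o, hoP, ho, -⟩ := hP.exists_interior_point ∅ (by simp)
  have hl := ho ∅ l hne.ne_empty.symm hP.cuts_empty
  -- A point positive on all facets lies in the cone; as `l` is positive there, it is a positive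
  -- multiple of a point of `P`.
  rcases hP.mem_hull_iff.1 (hP.mem_hull_of_pos hoP fun G a hG => ho G a hG.ne) with
    rfl | ⟨t, ht, p, hp, rfl⟩
  · simp at hl
  · refine ⟨p, hp, fun F a hF ha => ?_⟩
    have := ho F a hF ha
    rw [map_smul, smul_eq_mul] at this
    exact (mul_pos_iff_of_pos_left ht).1 this

/-- A face covered by a family of faces is contained in one of them. -/
lemma exists_subset_of_subset_iUnion (hP : PolytopeIn l P) {D : Set V} {a : V →ₗ[ℝ] ℝ}
    (hD : Cuts a P D) (hDne : D.Nonempty) {S : Set (Set V)}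
    (hS : ∀ K ∈ S, ∃ b : V →ₗ[ℝ] ℝ, Cuts b P K) (hDS : D ⊆ ⋃ K ∈ S, K) : ∃ K ∈ S, D ⊆ K := by
  -- A member `K` through a relatively interior point of `D` meets `D` in a face of `D` that cannot
  -- be proper.
  obtain ⟨p, hp, h⟩ := (hP.of_cuts hD).exists_relint hDne
  obtain ⟨K, hK, hpK⟩ := mem_iUnion₂.1 (hDS hp)
  obtain ⟨b, hb⟩ := hS K hK
  refine ⟨K, hK, ?_⟩
  have hcut := hb.restrict hD.subset
  by_contra hcon
  exact (h _ b (fun h => hcon (inter_eq_right.1 h)) hcut).ne' (hb.eq_zero hpK)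

end PolytopeIn

variable [FiniteDimensional ℝ V]

lemma IsFacetChain.finrank (hP : PolytopeIn l P) {p : List (Set V)} {F : Set V}
    (h : IsFacetChain P (p ++ [F])) :
    Module.finrank ℝ (Submodule.span ℝ F) + p.length = Module.finrank ℝ (Submodule.span ℝ P) := by
  induction p using List.reverseRecOn generalizing F with
  | nil =>
    rw [List.nil_append, isFacetChain_singleton] at h
    rw [h, List.length_nil, add_zero]
  | append_singleton p G ih =>
    rw [List.append_assoc, List.singleton_append, isFacetChain_append_pair] at h
    have h1 := ih h.1
    have h2 := h.2.finrank (h.1.polytopeIn hP (by simp))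
    simp only [List.length_append, List.length_singleton]
    omega

lemma IsFacetChain.finrank_of_append (hP : PolytopeIn l P) {p s : List (Set V)} {F : Set V}
    (h : IsFacetChain P (p ++ F :: s)) :
    Module.finrank ℝ (Submodule.span ℝ F) + p.length = Module.finrank ℝ (Submodule.span ℝ P) := by
  refine IsFacetChain.finrank hP (IsFacetChain.prefix (t := s) ?_ (by simp))
  simpa using h

lemma isCompleteFlag_iff (hP : PolytopeIn l P) {c : List (Set V)} :
    IsCompleteFlag P c ↔
      IsFacetChain P c ∧ c.length = Module.finrank ℝ (Submodule.span ℝ P) := by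
  unfold IsCompleteFlag
  refine and_congr_right fun hc => ?_
  rcases List.eq_nil_or_concat' c with rfl | ⟨p, F, rfl⟩
  · exact absurd hc.1 (by simp)
  · have h1 := hc.finrank hP
    have hF : PolytopeIn l F := hc.polytopeIn hP (by simp)
    simp only [List.getLast?_append, List.getLast?_singleton, Option.some_or, Option.some_inj,
      List.length_append, List.length_singleton]
    rw [← hF.finrank_eq_one_iff]
    omega

end Dimension

/-! ### Lexicographic order on flags and its exchange property. -/

section Flags

variable {V : Type*}

/-- The complete flags that continue the chain `c` by `n` further members, in lexicographic
order. -/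
def flagList (ord : List (Set V) → List (Set V)) : ℕ → List (Set V) → List (List (Set V))
  | 0, c => [c]
  | n + 1, c => (ord c).flatMap fun F => flagList ord n (c ++ [F])

variable {ord : List (Set V) → List (Set V)}

lemma flagList_prefix {n : ℕ} {c x : List (Set V)} (hx : x ∈ flagList ord n c) : c <+: x := by
  induction n generalizing c with
  | zero => simp [flagList] at hx; simp [hx]
  | succ n ih =>
    simp only [flagList, List.mem_flatMap] at hx
    obtain ⟨F, -, hF⟩ := hx
    exact (List.prefix_append c [F]).trans (ih hF)

lemma FlagLT.ne {x y : List (Set V)} (h : FlagLT ord x y) : x ≠ y := by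
  obtain ⟨p, s, t, F, G, rfl, rfl, hne, -⟩ := h
  intro h
  have := List.append_cancel_left h
  simp [hne] at this

variable [NormedAddCommGroup V] [NormedSpace ℝ V] [FiniteDimensional ℝ V]
  {l : V →ₗ[ℝ] ℝ} {P : Set V}

lemma IsRecursiveShelling.isShelling (hord : IsRecursiveShelling P ord) (hP : PolytopeIn l P)
    {p : List (Set V)} {F : Set V} (hc : IsFacetChain P (p ++ [F]))
    (hlen : (p ++ [F]).length < Module.finrank ℝ (Submodule.span ℝ P)) :
    IsShelling (boundaryComplex F) (ord (p ++ [F])) := by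
  refine hord.shelling p F hc ?_
  rw [(hc.polytopeIn hP (by simp)).nontrivial_iff]
  have := hc.finrank hP
  simp only [List.length_append, List.length_singleton] at hlen
  omega

lemma IsRecursiveShelling.mem_iff (hord : IsRecursiveShelling P ord) (hP : PolytopeIn l P)
    {p : List (Set V)} {F : Set V} (hc : IsFacetChain P (p ++ [F]))
    (hlen : (p ++ [F]).length < Module.finrank ℝ (Submodule.span ℝ P)) (G : Set V) :
    G ∈ ord (p ++ [F]) ↔ FacetOf G F := (hord.isShelling hP hc hlen).isFacetOrdering.2 G

lemma mem_flagList_iff (hord : IsRecursiveShelling P ord) (hP : PolytopeIn l P) {n : ℕ}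
    {c : List (Set V)} (hc : IsFacetChain P c)
    (hlen : c.length + n = Module.finrank ℝ (Submodule.span ℝ P)) (x : List (Set V)) :
    x ∈ flagList ord n c ↔ c <+: x ∧ IsCompleteFlag P x := by
  induction n generalizing c with
  | zero =>
    rw [isCompleteFlag_iff hP]
    simp only [flagList, List.mem_singleton]
    constructor
    · rintro rfl
      exact ⟨List.prefix_rfl, hc, hlen⟩
    · rintro ⟨h1, -, h2⟩
      exact (h1.eq_of_length (by omega)).symm
  | succ n ih =>
    rcases List.eq_nil_or_concat' c with rfl | ⟨p, F, rfl⟩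
    · exact absurd hc.1 (by simp)
    have hmem := hord.mem_iff hP hc (by omega)
    simp only [flagList, List.mem_flatMap]
    have hih : ∀ G, FacetOf G F → (x ∈ flagList ord n (p ++ [F] ++ [G]) ↔
        p ++ [F] ++ [G] <+: x ∧ IsCompleteFlag P x) := by
      intro G hG
      refine ih ?_ ?_
      · rw [List.append_assoc, List.singleton_append, isFacetChain_append_pair]
        exact ⟨hc, hG⟩
      · rw [← hlen]; simp; omega
    constructor
    · rintro ⟨G, hG, hx⟩
      obtain ⟨h1, h2⟩ := (hih G ((hmem G).1 hG)).1 hx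
      exact ⟨(List.prefix_append _ _).trans h1, h2⟩
    · rintro ⟨⟨t, rfl⟩, hx⟩
      cases t with
      | nil =>
        have := ((isCompleteFlag_iff hP).1 hx).2
        simp at this hlen
        omega
      | cons G t =>
        have hG : FacetOf G F := IsFacetChain.facetOf (p := p) (s := t) (by simpa using hx.1)
        refine ⟨G, (hmem G).2 hG, (hih G hG).2 ⟨⟨t, by simp⟩, hx⟩⟩

lemma pairwise_flagList (hord : IsRecursiveShelling P ord) (hP : PolytopeIn l P) {n : ℕ}
    {c : List (Set V)} (hc : IsFacetChain P c)
    (hlen : c.length + n = Module.finrank ℝ (Submodule.span ℝ P)) :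
    (flagList ord n c).Pairwise (FlagLT ord) := by
  induction n generalizing c with
  | zero => simp [flagList]
  | succ n ih =>
    rcases List.eq_nil_or_concat' c with rfl | ⟨p, F, rfl⟩
    · exact absurd hc.1 (by simp)
    have hsh := (hord.isShelling hP hc (by omega)).isFacetOrdering
    rw [flagList, List.pairwise_flatMap]
    constructor
    · intro G hG
      refine ih ?_ ?_
      · rw [List.append_assoc, List.singleton_append, isFacetChain_append_pair]
        exact ⟨hc, (hsh.2 G).1 hG⟩
      · rw [← hlen]; simp; omega
    · rw [List.pairwise_iff_forall_sublist]
      intro G H hGH x hx y hy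
      obtain ⟨s, rfl⟩ := flagList_prefix hx
      obtain ⟨t, rfl⟩ := flagList_prefix hy
      exact ⟨p ++ [F], s, t, G, H, by simp, by simp, Precedes.ne hsh.1 hGH, hGH⟩

theorem exists_isLexFlagList (hord : IsRecursiveShelling P ord) (hP : PolytopeIn l P)
    (hne : P.Nonempty) : ∃ L, IsLexFlagList P ord L := by
  have hpos := hP.finrank_pos_iff.2 hne
  have hc : IsFacetChain P [P] := isFacetChain_singleton.2 rfl
  have hlen : [P].length + (Module.finrank ℝ (Submodule.span ℝ P) - 1) =
      Module.finrank ℝ (Submodule.span ℝ P) := by simp; omega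
  have hpw := pairwise_flagList hord hP hc hlen
  refine ⟨_, hpw.imp fun h => h.ne, fun c => ?_, hpw⟩
  rw [mem_flagList_iff hord hP hc hlen]
  refine and_iff_right_of_imp fun h => ?_
  have := h.1.1
  cases c with
  | nil => simp at this
  | cons a c =>
    simp at this
    exact ⟨c, by simp [this]⟩

/-- Replacing one member of a complete flag. -/
lemma IsCompleteFlag.replace (hP : PolytopeIn l P) {p s : List (Set V)} {Q F K : Set V}
    (hx : IsCompleteFlag P (p ++ [Q] ++ F :: s)) (hK : FacetOf K Q)
    (hs : ∀ D ∈ s.head?, D ⊆ K) : IsCompleteFlag P (p ++ [Q] ++ K :: s) := by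
  rw [isCompleteFlag_iff hP] at hx ⊢
  obtain ⟨hx, hlen⟩ := hx
  refine ⟨⟨?_, ?_⟩, by simpa using hlen⟩
  · have := hx.1
    cases p <;> simpa using this
  have hchain := hx.2
  rw [List.isChain_append] at hchain ⊢
  obtain ⟨h1, h2, h3⟩ := hchain
  rw [List.isChain_cons] at h2
  have hQc : IsFacetChain P (p ++ [Q]) := hx.prefix (by simp)
  have hQP := hQc.polytopeIn hP (F := Q) (by simp)
  refine ⟨h1, List.isChain_cons.2 ⟨fun D hD => ?_, h2.2⟩, ?_⟩
  · have hDF : FacetOf D F := h2.1 D hD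
    have hDs : D ∈ s := List.mem_of_mem_head? hD
    have hKc : IsFacetChain P (p ++ [Q, K]) := isFacetChain_append_pair.2 ⟨hQc, hK⟩
    obtain ⟨a, ha⟩ := hKc.exists_cuts hP (F := K) (by simp)
    obtain ⟨b, hb⟩ := hx.exists_cuts hP (F := D) (by simp [hDs])
    have hF : PolytopeIn l F := hx.polytopeIn hP (by simp)
    have e1 := hDF.finrank hF
    have e2 := hK.finrank hQP
    have hFQ : FacetOf F Q := IsFacetChain.facetOf (p := p) (s := s) (by simpa using hx)
    have e3 := hFQ.finrank hQP
    -- `K` and `F` are both facets of `Q`, hence of equal rank, so `D` has corank one in `K` as it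
    -- has in `F`.
    refine (hP.of_cuts ha).facetOf_of_finrank (hb.restrict_of_subset ha.subset (hs D hD)) ?_ ?_
    · rintro rfl; omega
    · omega
  · intro A hA B hB
    simp only [List.head?_cons, Option.mem_some_iff] at hB
    simp only [List.getLast?_append, List.getLast?_singleton, Option.some_or,
      Option.mem_some_iff] at hA
    subst hA hB
    exact hK

/-- The exchange property of the lexicographic order, for two flags with given first and second
places of disagreement and subsequent agreement. -/
lemma exchange_aux (hord : IsRecursiveShelling P ord) (hP : PolytopeIn l P) (s₁ : List (Set V)) :
    ∀ (p s₂ : List (Set V)) (Q F G : Set V), IsCompleteFlag P (p ++ [Q] ++ F :: (s₁ ++ s₂)) →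
      Precedes (ord (p ++ [Q])) G F → (∀ D ∈ s₂.head?, D ⊆ G) →
      ∃ F₀ ∈ F :: s₁, ∃ z, IsCompleteFlag P z ∧
        FlagLT ord z (p ++ [Q] ++ F :: (s₁ ++ s₂)) ∧ F₀ ∉ z ∧
        ∀ H ∈ p ++ [Q] ++ F :: (s₁ ++ s₂), H ≠ F₀ → H ∈ z := by
  have base : ∀ (p s : List (Set V)) (Q F K : Set V), IsCompleteFlag P (p ++ [Q] ++ F :: s) →
      Precedes (ord (p ++ [Q])) K F → (∀ D ∈ s.head?, D ⊆ K) →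
      ∃ z, IsCompleteFlag P z ∧ FlagLT ord z (p ++ [Q] ++ F :: s) ∧ F ∉ z ∧
        ∀ H ∈ p ++ [Q] ++ F :: s, H ≠ F → H ∈ z := by
    intro p s Q F K hx hK hs
    have hQc : IsFacetChain P (p ++ [Q]) := hx.1.prefix (by simp)
    have hlen := ((isCompleteFlag_iff hP).1 hx).2
    have hlt : (p ++ [Q]).length < Module.finrank ℝ (Submodule.span ℝ P) := by
      rw [← hlen]; simp
    have hKQ := (hord.mem_iff hP hQc hlt K).1 hK.mem_left
    have hne := hK.ne (hord.isShelling hP hQc hlt).isFacetOrdering.1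
    refine ⟨_, hx.replace hP hKQ hs, ⟨p ++ [Q], s, s, K, F, rfl, rfl, hne, hK⟩, ?_, ?_⟩
    · have hnd := hx.1.nodup
      rw [List.nodup_append] at hnd
      obtain ⟨-, h2, h3⟩ := hnd
      intro hmem
      rcases List.mem_append.1 hmem with h | h
      · exact h3 F h F (by simp) rfl
      · rcases List.mem_cons.1 h with h | h
        · exact hne h.symm
        · exact (List.nodup_cons.1 h2).1 h
    · intro H hH hHF
      simp only [List.mem_append, List.mem_cons] at hH ⊢
      tauto
  induction s₁ with
  | nil =>
    intro p s₂ Q F G hx hG hs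
    obtain ⟨z, hz⟩ := base p s₂ Q F G hx hG hs
    exact ⟨F, by simp, z, hz⟩
  | cons F' s₁ ih =>
    intro p s₂ Q F G hx hG hs
    have hQc : IsFacetChain P (p ++ [Q]) := hx.1.prefix (by simp)
    have hx' : IsCompleteFlag P (p ++ [Q] ++ [F] ++ F' :: (s₁ ++ s₂)) := by simpa using hx
    have hFc : IsFacetChain P (p ++ [Q] ++ [F]) := hx'.1.prefix (by simp)
    have hFc' : IsFacetChain P (p ++ [Q, F]) := by simpa using hFc
    have hFF' : FacetOf F' F := IsFacetChain.facetOf (p := p ++ [Q]) (s := s₁ ++ s₂)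
      (by simpa using hx.1)
    have hlen := ((isCompleteFlag_iff hP).1 hx).2
    have hlt : (p ++ [Q]).length < Module.finrank ℝ (Submodule.span ℝ P) := by
      rw [← hlen]; simp
    have hltF : (p ++ [Q] ++ [F]).length < Module.finrank ℝ (Submodule.span ℝ P) := by
      rw [← hlen]; simp
    have hQP := hQc.polytopeIn hP (F := Q) (by simp)
    have hFP := hFc.polytopeIn hP (F := F) (by simp)
    have hQsh := hord.isShelling hP hQc hlt
    have hFsh := hord.isShelling hP hFc hltF
    have hface : ∀ y ∈ p ++ [Q] ++ F :: (F' :: s₁ ++ s₂), y.Nonempty := by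
      intro y hy
      rw [← (hx.1.polytopeIn hP hy).finrank_pos_iff]
      obtain ⟨u, w, huw⟩ := List.append_of_mem hy
      rw [huw] at hx
      have h1 := hx.1.finrank_of_append hP
      have h2 := ((isCompleteFlag_iff hP).1 hx).2
      simp at h2
      omega
    have hFn : F.Nontrivial := by
      rw [hFP.nontrivial_iff, ← hFF'.finrank hFP]
      have := (hFF'.polytopeIn hFP).finrank_pos_iff.2 (hface F' (by simp))
      omega
    have hKcut : ∀ K, Precedes (ord (p ++ [Q])) K F → ∃ b : V →ₗ[ℝ] ℝ, Cuts b P K := by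
      intro K hK
      have hKQ := (hord.mem_iff hP hQc hlt K).1 hK.mem_left
      exact (isFacetChain_append_pair.2 ⟨hQc, hKQ⟩ : IsFacetChain P (p ++ [Q, K])).exists_cuts hP
        (by simp)
    obtain ⟨r, hr, hinter⟩ := hord.initial p Q F hFc' hFn
    have heq : p ++ [Q, F] = p ++ [Q] ++ [F] := by simp
    rw [heq] at hr hinter
    -- If `F'` lies in the initial segment, it is covered by facets preceding `F`, hence contained
    -- in one, which can replace `F`. If not, the exchange is made further down.
    by_cases hF'r : F' ∈ (ord (p ++ [Q] ++ [F])).take r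
    · obtain ⟨a, ha⟩ := hx.1.exists_cuts hP (F := F') (by simp)
      obtain ⟨K, hK, hF'K⟩ := hP.exists_subset_of_subset_iUnion ha (hface F' (by simp))
        (S := {K | Precedes (ord (p ++ [Q])) K F}) hKcut (by
          intro y hy
          have : y ∈ ⋃ H ∈ (ord (p ++ [Q] ++ [F])).take r, H := mem_biUnion hF'r hy
          rw [← hinter] at this
          exact this.2)
      obtain ⟨z, hz⟩ := base p (F' :: s₁ ++ s₂) Q F K hx hK (by simpa using hF'K)
      exact ⟨F, by simp, z, hz⟩
    · obtain ⟨H, hHr, hHs⟩ : ∃ H ∈ (ord (p ++ [Q] ++ [F])).take r, ∀ D ∈ s₂.head?, D ⊆ H := by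
        have hHcut : ∀ H ∈ (ord (p ++ [Q] ++ [F])).take r, ∃ b : V →ₗ[ℝ] ℝ, Cuts b P H := by
          intro H hH
          have hHF := (hord.mem_iff hP hFc hltF H).1 (List.mem_of_mem_take hH)
          exact (isFacetChain_append_pair.2 ⟨hFc, hHF⟩ :
            IsFacetChain P (p ++ [Q] ++ [F, H])).exists_cuts hP (by simp)
        cases s₂ with
        | nil =>
          -- Without a later common member only a nonempty segment is needed. `initial` allows `r =
          -- 0`, so nonemptiness comes from the shelling of `∂Q`: as `G` precedes `F`, its clause `1
          -- ≤ r` shows that `F` meets the union of the earlier facets.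
          obtain ⟨N, hN, r', hr', hinter', h1⟩ :=
            hQsh.exists_next ((hord.mem_iff hP hQc hlt F).2 (isFacetChain_append_pair.1 hFc').2) hFn
          have h1 := h1 ⟨G, hG⟩
          have hlen0 : 0 < (N.take r').length := by simp; omega
          obtain ⟨E, hE⟩ := List.exists_mem_of_length_pos hlen0
          have hEF : FacetOf E F := (hN.isFacetOrdering.2 E).1 (List.mem_of_mem_take hE)
          obtain ⟨y, hy⟩ : E.Nonempty := by
            rw [← (hEF.polytopeIn hFP).finrank_pos_iff]
            have e1 := hEF.finrank hFP
            have e2 := hFP.nontrivial_iff.1 hFn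
            omega
          have hy' : y ∈ ⋃ H ∈ N.take r', H := mem_biUnion hE hy
          rw [← hinter', hinter] at hy'
          obtain ⟨H, hH, -⟩ := mem_iUnion₂.1 hy'
          exact ⟨H, hH, by simp⟩
        | cons D s₂ =>
          have hDG : D ⊆ G := hs D (by simp)
          have hDF : D ⊂ F := by
            have := hx.1.pairwise
            rw [List.pairwise_append] at this
            exact (List.pairwise_cons.1 this.2.1).1 D (by simp)
          obtain ⟨a, ha⟩ := hx.1.exists_cuts hP (F := D) (by simp)
          obtain ⟨H, hH, hDH⟩ := hP.exists_subset_of_subset_iUnion ha (hface D (by simp))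
            (S := {H | H ∈ (ord (p ++ [Q] ++ [F])).take r}) hHcut (by
              intro y hy
              change y ∈ ⋃ H ∈ (ord (p ++ [Q] ++ [F])).take r, H
              rw [← hinter]
              exact ⟨hDF.subset hy, mem_biUnion hG (hDG hy)⟩)
          exact ⟨H, hH, by simpa using hDH⟩
      have hprec : Precedes (ord (p ++ [Q] ++ [F])) H F' :=
        precedes_of_mem_take hFsh.isFacetOrdering.1 hHr
          ((hord.mem_iff hP hFc hltF F').2 hFF') hF'r
      obtain ⟨F₀, hF₀, z, hz1, hz2, hz3, hz4⟩ := ih (p ++ [Q]) s₂ F F' H hx' hprec hHs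
      refine ⟨F₀, List.mem_cons_of_mem _ hF₀, z, hz1, by simpa using hz2, hz3, ?_⟩
      simpa using hz4

/-- The exchange property of the lexicographic order on flags. -/
theorem IsRecursiveShelling.exchange (hord : IsRecursiveShelling P ord) (hP : PolytopeIn l P)
    {x y : List (Set V)} (hx : IsCompleteFlag P x) (hy : IsCompleteFlag P y)
    (hlt : FlagLT ord y x) :
    ∃ F₀ ∈ x, F₀ ∉ y ∧ ∃ z, IsCompleteFlag P z ∧ FlagLT ord z x ∧ F₀ ∉ z ∧
      ∀ H ∈ x, H ≠ F₀ → H ∈ z := by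
  classical
  obtain ⟨p, t, s, G, F, rfl, rfl, hne, hGF⟩ := hlt
  rcases List.eq_nil_or_concat' p with rfl | ⟨p, Q, rfl⟩
  · have h1 := hx.1.1
    have h2 := hy.1.1
    simp at h1 h2
    exact absurd (h2.trans h1.symm) hne
  -- `s` is split at its first member shared with the rest of `y`; this ensures that whatever is
  -- exchanged is not in `y`.
  have hs := List.takeWhile_append_dropWhile (p := fun D => decide (D ∉ G :: t)) (l := s)
  set s₁ := s.takeWhile (fun D => decide (D ∉ G :: t)) with hs₁
  set s₂ := s.dropWhile (fun D => decide (D ∉ G :: t)) with hs₂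
  have hs₁' : ∀ D ∈ s₁, D ∉ G :: t := fun D hD => by
    simpa using List.mem_takeWhile_imp hD
  have hs₂' : ∀ D ∈ s₂.head?, D ⊆ G := by
    intro D hD
    have hDt : D ∈ G :: t := by
      have := List.head?_dropWhile_not (fun D => decide (D ∉ G :: t)) s
      rw [← hs₂] at this
      rw [Option.mem_def] at hD
      rw [hD] at this
      by_contra hcon
      simp [hcon] at this
    rcases List.mem_cons.1 hDt with rfl | hDt
    · exact subset_rfl
    · have := hy.1.pairwise
      rw [List.pairwise_append] at this
      exact ((List.pairwise_cons.1 this.2.1).1 D hDt).subset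
  rw [← hs] at hx ⊢
  obtain ⟨F₀, hF₀, z, hz⟩ := exchange_aux hord hP s₁ p s₂ Q F G hx hGF hs₂'
  have hnd := hx.1.nodup
  rw [List.nodup_append] at hnd
  have hF₀' : F₀ ∈ F :: (s₁ ++ s₂) := by
    rcases List.mem_cons.1 hF₀ with h | h
    · simp [h]
    · simp [h]
  refine ⟨F₀, List.mem_append_right _ hF₀', fun hmem => ?_, z, hz⟩
  rcases List.mem_append.1 hmem with h | h
  · exact hnd.2.2 F₀ h F₀ hF₀' rfl
  · rcases List.mem_cons.1 hF₀ with rfl | h'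
    · rcases List.mem_cons.1 h with h | h
      · exact hne h.symm
      -- If `y` contained `F` below `G`, then `F` would be strictly inside `G`; but both stand at
      -- the same place of a facet chain and have equal rank.
      · have hFG : F₀ ⊂ G := by
          have := hy.1.pairwise
          rw [List.pairwise_append] at this
          exact (List.pairwise_cons.1 this.2.1).1 F₀ h
        obtain ⟨a, ha⟩ := hx.1.exists_cuts hP (F := F₀) (by simp)
        have e1 := hx.1.finrank_of_append hP
        have e2 := hy.1.finrank_of_append hP
        obtain ⟨b, hb⟩ := hy.1.exists_cuts hP (F := G) (by simp)
        have := (ha.restrict_of_subset hb.subset hFG.subset).finrank_lt hFG.ne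
        omega
    · exact hs₁' F₀ h' h

end Flags

/-! ### Simplices spanned by barycenters of chains of faces. -/

section ChainSimplices

variable {V : Type*} [NormedAddCommGroup V] [NormedSpace ℝ V]

/-- `r F` is a point of `F` that lies on no face of `P` not containing `F`. -/
structure IsBarycenter (P : Set V) (r : Set V → V) : Prop where
  mem : ∀ (F : Set V) (a : V →ₗ[ℝ] ℝ), Cuts a P F → F.Nonempty → r F ∈ F
  subset : ∀ (F G : Set V) (a b : V →ₗ[ℝ] ℝ), Cuts a P F → F.Nonempty → Cuts b P G → r F ∈ G →
    F ⊆ G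

/-- A finite chain of nonempty faces of `P`. -/
structure IsFaceChain (P : Set V) (C : Finset (Set V)) : Prop where
  nonempty : ∀ F ∈ C, F.Nonempty
  exists_cuts : ∀ F ∈ C, ∃ a : V →ₗ[ℝ] ℝ, Cuts a P F
  chain : ∀ F ∈ C, ∀ G ∈ C, F ⊆ G ∨ G ⊆ F

/-- The simplex spanned by the points `r F` for `F ∈ C`. -/
def chainSimplex (r : Set V → V) (C : Finset (Set V)) : Set V :=
  convexHull ℝ (r '' C)

variable {l : V →ₗ[ℝ] ℝ} {P : Set V} {r : Set V → V} {C D : Finset (Set V)}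

lemma IsFaceChain.mono (hC : IsFaceChain P C) (h : D ⊆ C) : IsFaceChain P D :=
  ⟨fun F hF => hC.nonempty F (h hF), fun F hF => hC.exists_cuts F (h hF),
    fun F hF G hG => hC.chain F (h hF) G (h hG)⟩

lemma IsFaceChain.exists_greatest (hC : IsFaceChain P C) (hne : C.Nonempty) :
    ∃ F ∈ C, ∀ G ∈ C, G ⊆ F := by
  obtain ⟨F, hF⟩ := C.finite_toSet.exists_maximal hne
  refine ⟨F, hF.1, fun G hG => ?_⟩
  rcases hC.chain F hF.1 G hG with h | h
  · exact hF.2 hG h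
  · exact h

lemma IsBarycenter.mem_of_mem (hr : IsBarycenter P r) (hC : IsFaceChain P C) {F : Set V}
    (hF : F ∈ C) : r F ∈ F :=
  let ⟨a, ha⟩ := hC.exists_cuts F hF
  hr.mem F a ha (hC.nonempty F hF)

lemma IsFaceChain.mem_polytope (hC : IsFaceChain P C) (hr : IsBarycenter P r) {F : Set V}
    (hF : F ∈ C) : r F ∈ P :=
  let ⟨_, ha⟩ := hC.exists_cuts F hF
  ha.subset (hr.mem_of_mem hC hF)

/-- The weights live on all sets and vanish off `C`, so that weights for different chains can be
compared as functions. -/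
lemma mem_chainSimplex_iff {x : V} : x ∈ chainSimplex r C ↔
    ∃ w : Set V → ℝ, (∀ F, 0 ≤ w F) ∧ (∀ F, F ∉ C → w F = 0) ∧ ∑ F ∈ C, w F = 1 ∧
      ∑ F ∈ C, w F • r F = x := by
  classical
  constructor
  · intro hx
    let S : Set V := {x | ∃ w : Set V → ℝ, (∀ F, 0 ≤ w F) ∧ (∀ F, F ∉ C → w F = 0) ∧
      ∑ F ∈ C, w F = 1 ∧ ∑ F ∈ C, w F • r F = x}
    have hS : chainSimplex r C ⊆ S := by
      refine convexHull_min ?_ ?_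
      · rintro _ ⟨F, hF, rfl⟩
        have hF : F ∈ C := hF
        refine ⟨fun G => if G = F then 1 else 0, fun G => by dsimp only; split_ifs <;> simp,
          fun G hG => if_neg (by rintro rfl; exact hG hF), ?_, ?_⟩
        · rw [Finset.sum_ite_eq' C F]; simp [hF]
        · simp [hF]
      · rintro x ⟨w, hw, hw0, hw1, rfl⟩ y ⟨u, hu, hu0, hu1, rfl⟩ a b ha hb hab
        refine ⟨fun F => a * w F + b * u F, fun F => ?_, fun F hF => ?_, ?_, ?_⟩
        · have := hw F
          have := hu F
          positivity
        · simp [hw0 F hF, hu0 F hF]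
        · rw [Finset.sum_add_distrib, ← Finset.mul_sum, ← Finset.mul_sum, hw1, hu1]
          simpa using hab
        · simp only [add_smul, mul_smul, Finset.sum_add_distrib, Finset.smul_sum]
    exact hS hx
  · rintro ⟨w, hw, -, hw1, rfl⟩
    exact (convex_convexHull ℝ _).sum_mem (fun F _ => hw F) hw1
      fun F hF => subset_convexHull ℝ _ (mem_image_of_mem r hF)

/-- Nonnegative combinations of the points `r F` with the `F` in a chain have unique coefficients,
even if the chain is allowed to vary. -/
lemma IsBarycenter.coeff_unique (hr : IsBarycenter P r) (hP : PolytopeIn l P)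
    (hC : IsFaceChain P C) (hD : IsFaceChain P D) {w u : Set V → ℝ}
    (hw : ∀ F, 0 ≤ w F) (hw0 : ∀ F, F ∉ C → w F = 0)
    (hu : ∀ F, 0 ≤ u F) (hu0 : ∀ F, F ∉ D → u F = 0)
    (h : ∑ F ∈ C, w F • r F = ∑ F ∈ D, u F • r F) : w = u := by
  classical
  -- Cancelling the common part leaves equal positive combinations over chains `S` and `T` with no
  -- common member; both turn out to be empty.
  let m : Set V → ℝ := fun F => min (w F) (u F)
  have hCE : ∑ F ∈ C ∪ D, w F • r F = ∑ F ∈ C, w F • r F :=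
    (Finset.sum_subset Finset.subset_union_left fun F _ hF => by simp [hw0 F hF]).symm
  have hDE : ∑ F ∈ C ∪ D, u F • r F = ∑ F ∈ D, u F • r F :=
    (Finset.sum_subset Finset.subset_union_right fun F _ hF => by simp [hu0 F hF]).symm
  let S := (C ∪ D).filter (fun F => 0 < w F - m F)
  let T := (C ∪ D).filter (fun F => 0 < u F - m F)
  have hSC : S ⊆ C := by
    intro F hF
    have h1 := (Finset.mem_filter.1 hF).2
    by_contra hFC
    have := hu F
    simp [m, hw0 F hFC, this] at h1
  have hTD : T ⊆ D := by
    intro F hF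
    have h1 := (Finset.mem_filter.1 hF).2
    by_contra hFC
    have := hw F
    simp [m, hu0 F hFC, this] at h1
  have hSsum : ∑ F ∈ C ∪ D, (w F - m F) • r F = ∑ F ∈ S, (w F - m F) • r F := by
    refine (Finset.sum_subset (Finset.filter_subset _ _) fun F hF hFS => ?_).symm
    have : w F - m F = 0 := by
      refine le_antisymm (not_lt.1 fun h => hFS (Finset.mem_filter.2 ⟨hF, h⟩)) ?_
      simp [m]
    rw [this, zero_smul]
  have hTsum : ∑ F ∈ C ∪ D, (u F - m F) • r F = ∑ F ∈ T, (u F - m F) • r F := by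
    refine (Finset.sum_subset (Finset.filter_subset _ _) fun F hF hFS => ?_).symm
    have : u F - m F = 0 := by
      refine le_antisymm (not_lt.1 fun h => hFS (Finset.mem_filter.2 ⟨hF, h⟩)) ?_
      simp [m]
    rw [this, zero_smul]
  have heq : ∑ F ∈ S, (w F - m F) • r F = ∑ F ∈ T, (u F - m F) • r F := by
    rw [← hSsum, ← hTsum]
    simp only [sub_smul, Finset.sum_sub_distrib]
    rw [hCE, hDE, h]
  have hS : IsFaceChain P S := hC.mono hSC
  have hT : IsFaceChain P T := hD.mono hTD
  have hSpos : ∀ F ∈ S, 0 < w F - m F := fun F hF => (Finset.mem_filter.1 hF).2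
  have hTpos : ∀ F ∈ T, 0 < u F - m F := fun F hF => (Finset.mem_filter.1 hF).2
  -- A functional cutting out a face that contains all of `T` kills both sides, hence each `r F`
  -- with `F ∈ S`. Used both ways, it makes the greatest members of `S` and `T` coincide.
  have key : ∀ (S T : Finset (Set V)) (v v' : Set V → ℝ), IsFaceChain P S → IsFaceChain P T →
      (∀ F ∈ S, 0 < v F) → (∀ F ∈ T, 0 < v' F) →
      ∑ F ∈ S, v F • r F = ∑ F ∈ T, v' F • r F → ∀ G (b : V →ₗ[ℝ] ℝ), Cuts b P G →
      (∀ F ∈ T, F ⊆ G) → ∀ F ∈ S, F ⊆ G := by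
    intro S T v v' hS hT hv hv' heq G b hb hTG F hF
    have h1 := congrArg b heq
    simp only [map_sum, map_smul, smul_eq_mul] at h1
    rw [Finset.sum_eq_zero (s := T) fun E hE => by
      rw [hb.eq_zero (hTG E hE (hr.mem_of_mem hT hE)), mul_zero]] at h1
    rw [Finset.sum_eq_zero_iff_of_nonneg fun E hE =>
      mul_nonneg (hv E hE).le (hb.nonneg _ (hS.mem_polytope hr hE))] at h1
    have h2 := (mul_eq_zero.1 (h1 F hF)).resolve_left (hv F hF).ne'
    obtain ⟨a, ha⟩ := hS.exists_cuts F hF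
    exact hr.subset F G a b ha (hS.nonempty F hF) hb
      ((hb.mem_iff _).2 ⟨hS.mem_polytope hr hF, h2⟩)
  have hlsum : ∀ (S : Finset (Set V)) (v : Set V → ℝ), IsFaceChain P S →
      l (∑ F ∈ S, v F • r F) = ∑ F ∈ S, v F := by
    intro S v hS
    rw [map_sum]
    refine Finset.sum_congr rfl fun F hF => ?_
    rw [map_smul, hP.apply_eq_one (hS.mem_polytope hr hF), smul_eq_mul, mul_one]
  -- Applying `l` equates the total weights, so neither of `S`, `T` can be empty without the other.
  have hl := congrArg l heq
  rw [hlsum S _ hS, hlsum T _ hT] at hl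
  have hempty : S = ∅ ∧ T = ∅ := by
    by_contra hne
    have hSne : S.Nonempty := by
      by_contra hS0
      rw [Finset.not_nonempty_iff_eq_empty] at hS0
      have hTne : T.Nonempty := by
        by_contra hT0
        exact hne ⟨hS0, Finset.not_nonempty_iff_eq_empty.1 hT0⟩
      have := Finset.sum_pos hTpos hTne
      rw [← hl, hS0] at this
      simp at this
    have hTne : T.Nonempty := by
      by_contra hT0
      have := Finset.sum_pos hSpos hSne
      rw [hl, Finset.not_nonempty_iff_eq_empty.1 hT0] at this
      simp at this
    obtain ⟨F, hF, hFmax⟩ := hS.exists_greatest hSne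
    obtain ⟨G, hG, hGmax⟩ := hT.exists_greatest hTne
    obtain ⟨a, ha⟩ := hS.exists_cuts F hF
    obtain ⟨b, hb⟩ := hT.exists_cuts G hG
    have h1 := key S T _ _ hS hT hSpos hTpos heq G b hb hGmax F hF
    have h2 := key T S _ _ hT hS hTpos hSpos heq.symm F a ha hFmax G hG
    obtain rfl := Subset.antisymm h1 h2
    have h3 := hSpos F hF
    have h4 := hTpos F hG
    simp only [m] at h3 h4
    rcases min_choice (w F) (u F) with h | h <;> rw [h] at h3 h4 <;> linarith
  ext F
  by_cases hF : F ∈ C ∪ D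
  · have h1 : ¬ 0 < w F - m F := fun h =>
      Finset.notMem_empty F (hempty.1 ▸ Finset.mem_filter.2 ⟨hF, h⟩)
    have h2 : ¬ 0 < u F - m F := fun h =>
      Finset.notMem_empty F (hempty.2 ▸ Finset.mem_filter.2 ⟨hF, h⟩)
    have h3 : m F ≤ w F := min_le_left _ _
    have h4 : m F ≤ u F := min_le_right _ _
    linarith
  · rw [Finset.mem_union, not_or] at hF
    rw [hw0 F hF.1, hu0 F hF.2]

lemma IsBarycenter.chainSimplex_inter [DecidableEq (Set V)] (hr : IsBarycenter P r)
    (hP : PolytopeIn l P) (hC : IsFaceChain P C) (hD : IsFaceChain P D) :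
    chainSimplex r C ∩ chainSimplex r D = chainSimplex r (C ∩ D) := by
  apply Subset.antisymm
  · rintro x ⟨hx, hy⟩
    obtain ⟨w, hw, hw0, hw1, rfl⟩ := mem_chainSimplex_iff.1 hx
    obtain ⟨u, hu, hu0, hu1, hux⟩ := mem_chainSimplex_iff.1 hy
    obtain rfl := hr.coeff_unique hP hC hD hw hw0 hu hu0 hux.symm
    have h0 : ∀ F ∈ C, F ∉ C ∩ D → w F = 0 := fun F hF hFD =>
      hu0 F fun h => hFD (Finset.mem_inter.2 ⟨hF, h⟩)
    refine mem_chainSimplex_iff.2 ⟨w, hw, fun F hF => ?_, ?_, ?_⟩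
    · by_cases hFC : F ∈ C
      · exact h0 F hFC hF
      · exact hw0 F hFC
    · rw [← hw1]
      exact Finset.sum_subset Finset.inter_subset_left h0
    · exact Finset.sum_subset Finset.inter_subset_left fun F hF hFD => by simp [h0 F hF hFD]
  · refine subset_inter ?_ ?_
    · exact convexHull_mono (image_mono (by simp))
    · exact convexHull_mono (image_mono (by simp))

lemma chainSimplex_mono (h : C ⊆ D) : chainSimplex r C ⊆ chainSimplex r D :=
  convexHull_mono (image_mono (by exact_mod_cast h))

lemma IsBarycenter.chainSimplex_subset_iff (hr : IsBarycenter P r)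
    (hP : PolytopeIn l P) (hC : IsFaceChain P C) (hD : IsFaceChain P D) :
    chainSimplex r C ⊆ chainSimplex r D ↔ C ⊆ D := by
  classical
  refine ⟨fun h F hF => ?_, chainSimplex_mono⟩
  have h1 : r F ∈ chainSimplex r D := h (subset_convexHull ℝ _ (mem_image_of_mem r hF))
  obtain ⟨u, hu, hu0, hu1, hux⟩ := mem_chainSimplex_iff.1 h1
  have := hr.coeff_unique hP hC hD (w := fun G => if G = F then 1 else 0)
    (fun G => by split_ifs <;> simp)
    (fun G hG => if_neg (by rintro rfl; exact hG hF)) hu hu0 (by rw [hux]; simp [hF])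
  by_contra hFD
  have h2 := congrFun this F
  simp [hu0 F hFD] at h2

lemma IsBarycenter.chainSimplex_injective (hr : IsBarycenter P r)
    (hP : PolytopeIn l P) (hC : IsFaceChain P C) (hD : IsFaceChain P D)
    (h : chainSimplex r C = chainSimplex r D) : C = D :=
  Finset.Subset.antisymm ((hr.chainSimplex_subset_iff hP hC hD).1 h.subset)
    ((hr.chainSimplex_subset_iff hP hD hC).1 h.superset)

/-- The positive and negative parts of a linear relation are nonnegative combinations over the same
chain, to which uniqueness of coefficients applies. -/
lemma IsBarycenter.linearIndependent (hr : IsBarycenter P r) (hP : PolytopeIn l P)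
    (hC : IsFaceChain P C) : LinearIndependent ℝ (fun F : C => r F) := by
  classical
  rw [Fintype.linearIndependent_iff]
  intro g hg
  let e : Set V → ℝ := fun F => if h : F ∈ C then g ⟨F, h⟩ else 0
  have he : ∑ F ∈ C, e F • r F = 0 := by
    rw [← hg, ← Finset.sum_coe_sort]
    exact Finset.sum_congr rfl fun F _ => by simp [e]
  have := hr.coeff_unique hP hC hC (w := fun F => max (e F) 0) (u := fun F => max (-e F) 0)
    (fun F => le_max_right _ _) (fun F hF => by simp [e, hF]) (fun F => le_max_right _ _)
    (fun F hF => by simp [e, hF]) (by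
      rw [← sub_eq_zero, ← Finset.sum_sub_distrib, ← he]
      refine Finset.sum_congr rfl fun F _ => ?_
      rw [← sub_smul]
      congr 1
      rcases le_total (e F) 0 with h | h
      · rw [max_eq_right h, max_eq_left (by linarith)]; ring
      · rw [max_eq_left h, max_eq_right (by linarith)]; ring)
  rintro ⟨F, hF⟩
  have h1 := congrFun this F
  have h2 : e F = g ⟨F, hF⟩ := by simp [e, hF]
  rw [← h2]
  rcases le_total (e F) 0 with h | h
  · rw [max_eq_right h, max_eq_left (by linarith)] at h1; linarith
  · rw [max_eq_left h, max_eq_right (by linarith)] at h1; linarith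

lemma IsBarycenter.exists_functional (hr : IsBarycenter P r) (hP : PolytopeIn l P)
    (hC : IsFaceChain P C) (v : Set V → ℝ) : ∃ a : V →ₗ[ℝ] ℝ, ∀ F ∈ C, a (r F) = v F := by
  let b := Module.Basis.span (hr.linearIndependent hP hC)
  obtain ⟨a, ha⟩ := LinearMap.exists_extend (b.constr ℝ (fun F : C => v F))
  refine ⟨a, fun F hF => ?_⟩
  have h1 : b.constr ℝ (fun F : C => v F) (b ⟨F, hF⟩) = v F := b.constr_basis ℝ _ _
  rw [← ha] at h1
  simpa [b, Module.Basis.span_apply] using h1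

lemma chainSimplex_eq_finset [DecidableEq V] :
    chainSimplex r C = convexHull ℝ ((C.image r : Finset V) : Set V) := by
  simp [chainSimplex]

lemma IsBarycenter.polytopeIn_chainSimplex (hr : IsBarycenter P r) (hP : PolytopeIn l P)
    (hC : IsFaceChain P C) : PolytopeIn l (chainSimplex r C) := by
  classical
  refine ⟨_, chainSimplex_eq_finset, fun x hx => ?_⟩
  obtain ⟨F, hF, rfl⟩ := Finset.mem_image.1 hx
  exact hP.apply_eq_one (hC.mem_polytope hr hF)

/-- By linear independence some functional is 0 on the vertices from `D` and 1 on the other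
vertices, so every subset of the vertices spans a face. -/
lemma IsBarycenter.exists_cuts_chainSimplex_iff (hr : IsBarycenter P r) (hP : PolytopeIn l P)
    (hC : IsFaceChain P C) (G : Set V) :
    (∃ a : V →ₗ[ℝ] ℝ, Cuts a (chainSimplex r C) G) ↔ ∃ D ⊆ C, G = chainSimplex r D := by
  classical
  have himage : ∀ a : V →ₗ[ℝ] ℝ, {y | y ∈ C.image r ∧ a y = 0} =
      r '' (C.filter (fun F => a (r F) = 0) : Finset (Set V)) := by
    intro a
    ext y
    simp only [Finset.mem_image, mem_ofPred_eq, mem_image, Finset.coe_filter]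
    constructor
    · rintro ⟨⟨F, hF, rfl⟩, h⟩; exact ⟨F, ⟨hF, h⟩, rfl⟩
    · rintro ⟨F, ⟨hF, h⟩, rfl⟩; exact ⟨⟨F, hF, rfl⟩, h⟩
  constructor
  · rintro ⟨a, ha⟩
    rw [chainSimplex_eq_finset] at ha
    refine ⟨C.filter (fun F => a (r F) = 0), Finset.filter_subset _ _, ?_⟩
    rw [ha.eq_convexHull, himage]; rfl
  · rintro ⟨D, hDC, rfl⟩
    obtain ⟨a, ha⟩ := hr.exists_functional hP hC (fun F => if F ∈ D then 0 else 1)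
    refine ⟨a, ?_⟩
    have h := cuts_of_generators (s := C.image r) (a := a) (fun x hx => by
      obtain ⟨F, hF, rfl⟩ := Finset.mem_image.1 hx
      rw [ha F hF]; split_ifs <;> simp)
    rw [himage, ← chainSimplex_eq_finset] at h
    convert h using 1
    unfold chainSimplex
    congr 3
    ext F
    rw [Finset.mem_filter]
    constructor
    · intro hF
      exact ⟨hDC hF, by rw [ha F (hDC hF), if_pos hF]⟩
    · rintro ⟨hF, h0⟩
      by_contra hFD
      rw [ha F hF, if_neg hFD] at h0
      exact one_ne_zero h0

lemma IsBarycenter.isSimplex_chainSimplex (hr : IsBarycenter P r) (hP : PolytopeIn l P)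
    (hC : IsFaceChain P C) : IsSimplex (chainSimplex r C) := by
  classical
  refine ⟨C.image r, ?_, chainSimplex_eq_finset⟩
  have h := (hr.linearIndependent hP hC).affineIndependent.range
  have hrange : Set.range (fun F : C => r F) = ((C.image r : Finset V) : Set V) := by
    ext y; simp
  rw [hrange] at h
  exact h

lemma IsBarycenter.finrank_vectorSpan (hr : IsBarycenter P r) (hP : PolytopeIn l P)
    (hC : IsFaceChain P C) {n : ℕ} (hn : C.card = n + 1) :
    Module.finrank ℝ (vectorSpan ℝ (chainSimplex r C)) = n := by
  have h := (hr.linearIndependent hP hC).affineIndependent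
  have hrange : Set.range (fun F : C => r F) = r '' C := by
    ext y; simp
  rw [chainSimplex, ← direction_affineSpan, affineSpan_convexHull, direction_affineSpan, ← hrange]
  exact h.finrank_vectorSpan (by simpa using hn)

variable [FiniteDimensional ℝ V]

lemma IsBarycenter.mem_boundary_chainSimplex_iff (hr : IsBarycenter P r) (hP : PolytopeIn l P)
    (hC : IsFaceChain P C) (G : Set V) :
    G ∈ boundaryComplex (chainSimplex r C) ↔ ∃ D ⊂ C, G = chainSimplex r D := by
  rw [(hr.polytopeIn_chainSimplex hP hC).mem_boundary_iff, hr.exists_cuts_chainSimplex_iff hP hC]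
  constructor
  · rintro ⟨⟨D, hD, rfl⟩, hne⟩
    exact ⟨D, hD.ssubset_of_ne fun h => hne (by rw [h]), rfl⟩
  · rintro ⟨D, hD, rfl⟩
    exact ⟨⟨D, hD.subset, rfl⟩, fun h =>
      hD.ne (hr.chainSimplex_injective hP (hC.mono hD.subset) hC h)⟩

lemma IsBarycenter.facetOf_chainSimplex_iff [DecidableEq (Set V)] (hr : IsBarycenter P r)
    (hP : PolytopeIn l P) (hC : IsFaceChain P C) (G : Set V) :
    FacetOf G (chainSimplex r C) ↔ ∃ F ∈ C, G = chainSimplex r (C.erase F) := by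
  have hb := hr.mem_boundary_chainSimplex_iff hP hC
  constructor
  · intro hG
    obtain ⟨D, hD, rfl⟩ := (hb G).1 hG.1
    obtain ⟨F, hF, hFD⟩ := Finset.exists_of_ssubset hD
    refine ⟨F, hF, ?_⟩
    have hDF : D ⊆ C.erase F := fun E hE => Finset.mem_erase.2 ⟨by rintro rfl; exact hFD hE,
      hD.subset hE⟩
    exact Subset.antisymm (chainSimplex_mono hDF)
      (hG.2 ((hb _).2 ⟨_, Finset.erase_ssubset hF, rfl⟩) (chainSimplex_mono hDF))
  · rintro ⟨F, hF, rfl⟩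
    refine ⟨(hb _).2 ⟨_, Finset.erase_ssubset hF, rfl⟩, fun G hG hle => ?_⟩
    obtain ⟨D, hD, rfl⟩ := (hb G).1 hG
    have hDC := hC.mono hD.subset
    have h1 := (hr.chainSimplex_subset_iff hP (hC.mono (Finset.erase_subset F C)) hDC).1 hle
    refine chainSimplex_mono fun E hE => Finset.mem_erase.2 ⟨?_, hD.subset hE⟩
    rintro rfl
    refine hD.not_subset fun A hA => ?_
    rcases eq_or_ne A E with rfl | hne
    · exact hE
    · exact h1 (Finset.mem_erase.2 ⟨hne, hA⟩)

/-- Every ordering of the facets of a simplex is a shelling of its boundary. -/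
lemma IsBarycenter.isShelling_boundary [DecidableEq (Set V)] (hr : IsBarycenter P r)
    (hP : PolytopeIn l P) (t : List (Set V)) (ht : t.Nodup) (hC : IsFaceChain P t.toFinset) :
    IsShelling (boundaryComplex (chainSimplex r t.toFinset))
      (t.map fun F => chainSimplex r (t.toFinset.erase F)) := by
  induction hn : t.length generalizing t with
  | zero =>
    obtain rfl := List.length_eq_zero_iff.1 hn
    refine IsShelling.points _ _ ⟨by simp, fun G => ?_⟩ fun G hG => ?_
    · change _ ↔ FacetOf _ _
      rw [hr.facetOf_chainSimplex_iff hP hC]; simp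
    · obtain ⟨D, hD, -⟩ := (hr.mem_boundary_chainSimplex_iff hP hC G).1 hG
      simp at hD
  | succ n ih =>
    have herase : ∀ F, IsFaceChain P (t.toFinset.erase F) := fun F =>
      hC.mono (Finset.erase_subset _ _)
    have hlen : ∀ j : Fin (t.map fun F => chainSimplex r (t.toFinset.erase F)).length,
        (j : ℕ) < t.length := fun j => by simpa using j.2
    have hfin : ∀ j (hj : j < t.length), (t.eraseIdx j).toFinset = t.toFinset.erase t[j] := by
      intro j hj
      ext F
      rw [List.mem_toFinset, Finset.mem_erase, List.mem_toFinset, ← ht.erase_getElem j hj,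
        ht.mem_erase_iff]
    -- The facet opposite `t[j]` is shelled in the order of `t` with `t[j]` deleted. The first `j`
    -- entries are unaffected by the deletion and give the intersections with the earlier facets, so
    -- `r = j`.
    refine IsShelling.step _ _ ⟨?_, fun G => ?_⟩
      (fun j => (t.eraseIdx j).map fun F => chainSimplex r ((t.eraseIdx j).toFinset.erase F))
      (fun j => ?_) (fun j hj => ⟨j, hj, ?_, ?_⟩)
    · refine List.Nodup.map_on (fun F hF G hG h => ?_) ht
      have := hr.chainSimplex_injective hP (herase F) (herase G) h
      by_contra hne
      have h1 : F ∈ t.toFinset.erase G := by simp [hne, hF]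
      rw [← this] at h1
      simp at h1
    · change _ ↔ FacetOf _ _
      rw [hr.facetOf_chainSimplex_iff hP hC]
      simp [eq_comm]
    · have hj := hlen j
      have h1 := ih (t.eraseIdx j) (ht.eraseIdx _)
        (by rw [hfin j hj]; exact herase _) (by rw [List.length_eraseIdx_of_lt hj]; omega)
      convert h1 using 2
      rw [hfin j hj]
      simp
    · have hj := hlen j
      have h1 := List.length_eraseIdx_of_lt hj
      rw [← List.length_map (f := fun F => chainSimplex r ((t.eraseIdx j).toFinset.erase F))] at h1
      rw [h1]
      omega
    · have hj := hlen j
      rw [← List.map_take, ← List.map_take, List.take_eraseIdx_eq_take_of_le _ _ _ le_rfl, hfin j hj]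
      simp only [List.get_eq_getElem, List.getElem_map, List.mem_map, iUnion_exists, biUnion_and',
        iUnion_iUnion_eq_right, inter_iUnion]
      refine iUnion_congr fun F => iUnion_congr fun _ => ?_
      rw [hr.chainSimplex_inter hP (herase _) (herase _)]
      congr 1
      ext A
      simp only [Finset.mem_inter, Finset.mem_erase]
      tauto

end ChainSimplices

/-! ### The complex of flags and its lexicographic shelling. -/

section FlagComplex

variable {V : Type*} [NormedAddCommGroup V] [NormedSpace ℝ V]

open Classical in
/-- The barycentric subdivision of a polytope: its members are the simplices on subsets of complete
flags. -/
def flagComplex (P : Set V) (r : Set V → V) : Set (Set V) :=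
  {K | ∃ x, IsCompleteFlag P x ∧ ∃ S ⊆ x.toFinset, K = chainSimplex r S}

variable {l : V →ₗ[ℝ] ℝ} {P : Set V} {r : Set V → V}
  {ord : List (Set V) → List (Set V)} {x y : List (Set V)}

lemma IsCompleteFlag.toFinset_injective [DecidableEq (Set V)] (hx : IsCompleteFlag P x)
    (hy : IsCompleteFlag P y) (h : x.toFinset = y.toFinset) : x = y := by
  have hperm := List.perm_of_nodup_nodup_toFinset_eq hx.1.nodup hy.1.nodup h
  refine hperm.eq_of_pairwise (le := fun F G : Set V => G ⊂ F) ?_ hx.1.pairwise hy.1.pairwise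
  intro F G _ _ h1 h2
  exact absurd (h1.trans h2) (ssubset_irrefl _)

lemma flagSimplex_eq_chainSimplex [DecidableEq (Set V)] {ρ : PointedCone ℝ V → V}
    (x : List (Set V)) :
    flagSimplex ρ x = chainSimplex (fun F => ρ (PointedCone.hull ℝ F)) x.toFinset := by
  unfold flagSimplex chainSimplex
  congr 1
  ext v
  simp [eq_comm]

variable [FiniteDimensional ℝ V]

lemma IsCompleteFlag.nonempty (hP : PolytopeIn l P) (hx : IsCompleteFlag P x) {F : Set V}
    (hF : F ∈ x) : F.Nonempty := by
  rw [← (hx.1.polytopeIn hP hF).finrank_pos_iff]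
  obtain ⟨u, w, rfl⟩ := List.append_of_mem hF
  have h1 := hx.1.finrank_of_append hP
  have h2 := ((isCompleteFlag_iff hP).1 hx).2
  simp at h2
  omega

lemma IsCompleteFlag.isFaceChain [DecidableEq (Set V)] (hP : PolytopeIn l P)
    (hx : IsCompleteFlag P x) : IsFaceChain P x.toFinset where
  nonempty F hF := hx.nonempty hP (List.mem_toFinset.1 hF)
  exists_cuts F hF := hx.1.exists_cuts hP (List.mem_toFinset.1 hF)
  chain F hF G hG := by
    rw [List.mem_toFinset] at hF hG
    rcases eq_or_ne F G with rfl | hne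
    · exact Or.inl subset_rfl
    · have h : x.Pairwise (fun A B : Set V => A ⊆ B ∨ B ⊆ A) :=
        hx.1.pairwise.imp fun h => Or.inr h.subset
      have : Std.Symm (fun A B : Set V => A ⊆ B ∨ B ⊆ A) := ⟨fun A B h => h.symm⟩
      exact h.forall hF hG hne

lemma IsCompleteFlag.card_toFinset [DecidableEq (Set V)] (hP : PolytopeIn l P)
    (hx : IsCompleteFlag P x) :
    x.toFinset.card = Module.finrank ℝ (Submodule.span ℝ P) := by
  rw [List.toFinset_card_of_nodup hx.1.nodup, ((isCompleteFlag_iff hP).1 hx).2]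

lemma exists_isCompleteFlag (hP : PolytopeIn l P) (hne : P.Nonempty) :
    ∃ x, IsCompleteFlag P x := by
  obtain ⟨ord, hord⟩ := exists_isRecursiveShelling hP
  have hpos := hP.finrank_pos_iff.2 hne
  have key : ∀ (n : ℕ) (p : List (Set V)) (F : Set V), IsFacetChain P (p ++ [F]) →
      (p ++ [F]).length + n = Module.finrank ℝ (Submodule.span ℝ P) →
      ∃ x, IsCompleteFlag P x := by
    intro n
    induction n with
    | zero => exact fun p F hc hlen => ⟨_, (isCompleteFlag_iff hP).2 ⟨hc, hlen⟩⟩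
    | succ n ih =>
      intro p F hc hlen
      have hF := hc.polytopeIn hP (F := F) (by simp)
      have h1 := hc.finrank hP
      simp only [List.length_append, List.length_singleton] at hlen
      have hFne : F.Nonempty := hF.finrank_pos_iff.1 (by omega)
      obtain ⟨G, hG, -⟩ := hF.exists_facet hF.cuts_empty hFne.ne_empty.symm
      refine ih (p ++ [F]) G ?_ (by simp; omega)
      rw [List.append_assoc, List.singleton_append, isFacetChain_append_pair]
      exact ⟨hc, hG⟩
  exact key (Module.finrank ℝ (Submodule.span ℝ P) - 1) [] P (isFacetChain_singleton.2 rfl)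
    (by simp; omega)

lemma IsBarycenter.isSimplicialComplex_flagComplex (hr : IsBarycenter P r) (hP : PolytopeIn l P) :
    IsSimplicialComplex (flagComplex P r) := by
  rintro K ⟨x, hx, S, hS, rfl⟩
  exact hr.isSimplex_chainSimplex hP ((hx.isFaceChain hP).mono hS)

lemma IsBarycenter.isPolytopalComplex_flagComplex (hr : IsBarycenter P r) (hP : PolytopeIn l P)
    (hne : P.Nonempty) : IsPolytopalComplex (flagComplex P r) := by
  classical
  have hinter : ∀ K ∈ flagComplex P r, ∀ Q ∈ flagComplex P r, IsExposed ℝ K (K ∩ Q) := by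
    rintro K ⟨x, hx, S, hS, rfl⟩ Q ⟨y, hy, T, hT, rfl⟩
    have hSc := (hx.isFaceChain hP).mono hS
    have hTc := (hy.isFaceChain hP).mono hT
    rw [hr.chainSimplex_inter hP hSc hTc, (hr.polytopeIn_chainSimplex hP hSc).isExposed_iff,
      hr.exists_cuts_chainSimplex_iff hP hSc]
    exact ⟨_, Finset.inter_subset_left, rfl⟩
  refine ⟨?_, ?_, ?_, ?_, hinter, ?_⟩
  · refine ((hP.finite_faces.toFinset.powerset.finite_toSet).image (chainSimplex r)).subset ?_
    rintro K ⟨x, hx, S, hS, rfl⟩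
    refine ⟨S, ?_, rfl⟩
    rw [Finset.mem_coe, Finset.mem_powerset]
    intro F hF
    simpa using hx.1.exists_cuts hP (List.mem_toFinset.1 (hS hF))
  · obtain ⟨x, hx⟩ := exists_isCompleteFlag hP hne
    exact ⟨_, x, hx, _, Finset.Subset.refl _, rfl⟩
  · rintro K ⟨x, hx, S, hS, rfl⟩
    exact (hr.polytopeIn_chainSimplex hP ((hx.isFaceChain hP).mono hS)).isPolytope
  · rintro K ⟨x, hx, S, hS, rfl⟩ F hF
    have hSc := (hx.isFaceChain hP).mono hS
    rw [(hr.polytopeIn_chainSimplex hP hSc).isExposed_iff,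
      hr.exists_cuts_chainSimplex_iff hP hSc] at hF
    obtain ⟨T, hT, rfl⟩ := hF
    exact ⟨x, hx, T, hT.trans hS, rfl⟩
  · intro K hK Q hQ
    rw [inter_comm]
    exact hinter Q hQ K hK

/-- Complete flags all have the same number of members, so none of their simplices lies properly
inside another. -/
lemma IsBarycenter.mem_facets_flagComplex_iff [DecidableEq (Set V)] (hr : IsBarycenter P r)
    (hP : PolytopeIn l P) (K : Set V) :
    K ∈ complexFacets (flagComplex P r) ↔
      ∃ x, IsCompleteFlag P x ∧ K = chainSimplex r x.toFinset := by
  classical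
  have hmem : ∀ x, IsCompleteFlag P x → chainSimplex r x.toFinset ∈ flagComplex P r :=
    fun x hx => ⟨x, hx, _, fun F hF => by simpa using hF, rfl⟩
  constructor
  · rintro ⟨⟨x, hx, S, hS, rfl⟩, hmax⟩
    have hS' : S ⊆ x.toFinset := fun F hF => by simpa using hS hF
    exact ⟨x, hx, Subset.antisymm (chainSimplex_mono hS')
      (hmax (hmem x hx) (chainSimplex_mono hS'))⟩
  · rintro ⟨x, hx, rfl⟩
    refine ⟨hmem x hx, ?_⟩
    rintro Q ⟨y, hy, S, hS, rfl⟩ hle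
    have hS' : S ⊆ y.toFinset := fun F hF => by simpa using hS hF
    have hyc := hy.isFaceChain hP
    have h1 := (hr.chainSimplex_subset_iff hP (hx.isFaceChain hP) (hyc.mono hS')).1 hle
    have h2 := Finset.eq_of_subset_of_card_le (h1.trans hS')
      (by rw [hx.card_toFinset hP, hy.card_toFinset hP])
    rw [h2]
    exact chainSimplex_mono hS'

lemma IsBarycenter.isPureComplex_flagComplex (hr : IsBarycenter P r) (hP : PolytopeIn l P)
    (hne : P.Nonempty) : IsPureComplex (flagComplex P r) := by
  classical
  have hpos := hP.finrank_pos_iff.2 hne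
  have key : ∀ K ∈ complexFacets (flagComplex P r), Module.finrank ℝ (vectorSpan ℝ K) =
      Module.finrank ℝ (Submodule.span ℝ P) - 1 := by
    intro K hK
    obtain ⟨x, hx, rfl⟩ := (hr.mem_facets_flagComplex_iff hP K).1 hK
    exact hr.finrank_vectorSpan hP (hx.isFaceChain hP) (by rw [hx.card_toFinset hP]; omega)
  intro F hF G hG
  rw [key F hF, key G hG]

/-- The first place of disagreement is determined by the two flags, so both comparisons would use
the same duplicate-free list in opposite directions. -/
lemma FlagLT.asymm (hord : IsRecursiveShelling P ord) (hP : PolytopeIn l P)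
    (hx : IsCompleteFlag P x) (hy : IsCompleteFlag P y) (h : FlagLT ord x y) : ¬ FlagLT ord y x := by
  rintro ⟨p', t', s', G', F', hy', hx', hne', hGF⟩
  obtain ⟨p, s, t, F, G, hx0, hy0, hne, hFG⟩ := h
  have key : ∀ (p p' s s' t t' : List (Set V)) (F F' G G' : Set V), F ≠ G →
      p ++ F :: s = p' ++ F' :: s' → p ++ G :: t = p' ++ G' :: t' → p'.length ≤ p.length := by
    intro p p' s s' t t' F F' G G' hne h1 h2
    by_contra hlt
    push Not at hlt
    have e1 : (p ++ F :: s)[p.length]? = (p ++ G :: t)[p.length]? := by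
      rw [h1, h2, List.getElem?_append_left hlt, List.getElem?_append_left hlt]
    simp [hne] at e1
  have e1 : p ++ F :: s = p' ++ F' :: s' := hx0.symm.trans hx'
  have e2 : p ++ G :: t = p' ++ G' :: t' := hy0.symm.trans hy'
  have hlen := le_antisymm (key _ _ _ _ _ _ _ _ _ _ hne'.symm e1.symm e2.symm)
    (key _ _ _ _ _ _ _ _ _ _ hne e1 e2)
  obtain ⟨rfl, e3⟩ := List.append_inj e1 hlen
  obtain ⟨-, e4⟩ := List.append_inj e2 hlen
  obtain ⟨rfl, -⟩ := List.cons_eq_cons.1 e3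
  obtain ⟨rfl, -⟩ := List.cons_eq_cons.1 e4
  rw [hx0] at hx
  rw [hy0] at hy
  rcases List.eq_nil_or_concat' p with rfl | ⟨p, Q, rfl⟩
  · have hFP : F = P := by simpa using hx.1.1
    have hGP : G = P := by simpa using hy.1.1
    exact hne (hFP.trans hGP.symm)
  · have hlen := ((isCompleteFlag_iff hP).1 hx).2
    have hQc : IsFacetChain P (p ++ [Q]) := hx.1.prefix (by simp)
    have hnd := (hord.isShelling hP hQc (by rw [← hlen]; simp)).isFacetOrdering.1
    exact hFG.asymm hnd hGF

/-- The lexicographic order on flags is a shelling of the barycentric subdivision. -/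
theorem IsBarycenter.isShelling_flagComplex [DecidableEq (Set V)] (hr : IsBarycenter P r)
    (hP : PolytopeIn l P) (hord : IsRecursiveShelling P ord) {L : List (List (Set V))}
    (hL : IsLexFlagList P ord L) :
    IsShelling (flagComplex P r) (L.map fun x => chainSimplex r x.toFinset) := by
  classical
  obtain ⟨hnd, hmem, hpw⟩ := hL
  have hlen : ∀ j : Fin (L.map fun x => chainSimplex r x.toFinset).length, (j : ℕ) < L.length :=
    fun j => by simpa using j.2
  have hflag : ∀ (j : ℕ) (hj : j < L.length), IsCompleteFlag P L[j] := fun j hj =>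
    (hmem _).1 (List.getElem_mem hj)
  -- The ridge of `x` opposite `F` already lies in a simplex listed before position `j`. Such ridges
  -- are placed first in the shelling of the boundary of the simplex of `x`.
  let A : ℕ → List (Set V) → Set V → Prop := fun j x F =>
    ∃ z ∈ L.take j, F ∉ z ∧ ∀ H ∈ x, H ≠ F → H ∈ z
  let front : ℕ → List (Set V) → List (Set V) := fun j x => x.filter (fun F => A j x F)
  let t : ℕ → List (Set V) → List (Set V) := fun j x =>
    front j x ++ x.filter (fun F => ¬ A j x F)
  have hperm : ∀ j x, (t j x).Perm x := fun j x => by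
    simpa [t, front] using List.filter_append_perm (fun F => decide (A j x F)) x
  have htfin : ∀ j x, (t j x).toFinset = x.toFinset := fun j x =>
    List.toFinset_eq_of_perm _ _ (hperm j x)
  have hfront : ∀ j x F, F ∈ front j x ↔ F ∈ x ∧ A j x F := fun j x F => by simp [front]
  have hearlier : ∀ (j : ℕ) (hj : j < L.length) (z : List (Set V)), z ∈ L.take j →
      IsCompleteFlag P z ∧ FlagLT ord z L[j] := by
    intro j hj z hz
    obtain ⟨i, hi, rfl⟩ := List.mem_take_iff_getElem.1 hz
    have hij := lt_of_lt_of_le hi (min_le_left _ _)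
    exact ⟨hflag i _, List.pairwise_iff_getElem.1 hpw i j _ hj hij⟩
  have hexch : ∀ (j : ℕ) (hj : j < L.length) (y : List (Set V)), y ∈ L.take j →
      ∃ F ∈ front j L[j], F ∉ y := by
    intro j hj y hy
    obtain ⟨hyf, hlt⟩ := hearlier j hj y hy
    obtain ⟨F, hFx, hFy, z, hz, hzlt, hFz, hsub⟩ := hord.exchange hP (hflag j hj) hyf hlt
    refine ⟨F, (hfront _ _ _).2 ⟨hFx, z, ?_, hFz, hsub⟩, hFy⟩
    obtain ⟨i, hi, rfl⟩ := List.getElem_of_mem ((hmem z).2 hz)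
    -- The list is sorted and the order asymmetric, so `z`, being smaller than `L[j]`, stands before
    -- it.
    refine List.mem_take_iff_getElem.2 ⟨i, lt_min ?_ hi, rfl⟩
    by_contra hcon
    rcases (not_lt.1 hcon).eq_or_lt with rfl | hji
    · exact hzlt.ne rfl
    · exact hzlt.asymm hord hP hz (hflag j hj) (List.pairwise_iff_getElem.1 hpw j i hj hi hji)
  refine IsShelling.step _ _ ⟨?_, fun K => ?_⟩
    (fun j => (t j (L[j]'(hlen j))).map fun F =>
      chainSimplex r ((t j (L[j]'(hlen j))).toFinset.erase F))
    (fun j => ?_) (fun j hj => ⟨(front j (L[j]'(hlen j))).length, ?_, ?_, ?_⟩)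
  · refine List.Nodup.map_on (fun x hx y hy h => ?_) hnd
    rw [hmem] at hx hy
    exact hx.toFinset_injective hy
      (hr.chainSimplex_injective hP (hx.isFaceChain hP) (hy.isFaceChain hP) h)
  · rw [hr.mem_facets_flagComplex_iff hP]
    simp only [List.mem_map, hmem, eq_comm]
  · have hj := hlen j
    have hx := hflag j hj
    have h := hr.isShelling_boundary hP (t j L[j]) ((hperm _ _).nodup_iff.2 hx.1.nodup)
      (by rw [htfin]; exact hx.isFaceChain hP)
    convert h using 2
    rw [htfin]
    simp
  · have hj' := hlen j
    have h0 : 0 < L.length := lt_of_le_of_lt (Nat.zero_le _) hj'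
    obtain ⟨F, hF, -⟩ := hexch j hj' L[0]
      (List.mem_take_iff_getElem.2 ⟨0, lt_min hj h0, rfl⟩)
    exact List.length_pos_of_mem hF
  · simp [t]
  · have hj' := hlen j
    have hx := hflag j hj'
    have hxc := hx.isFaceChain hP
    have hget : (L.map fun x => chainSimplex r x.toFinset).get j =
        chainSimplex r (L[j]'hj').toFinset := by simp
    rw [hget, ← List.map_take, ← List.map_take]
    have htake : (t j (L[j]'hj')).take (front j (L[j]'hj')).length = front j (L[j]'hj') := by
      simp [t]
    rw [htake, htfin]
    set x := L[j]'hj'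
    change IsFaceChain P x.toFinset at hxc
    ext v
    simp only [mem_inter_iff, mem_iUnion, List.mem_map, exists_prop, exists_exists_and_eq_and]
    constructor
    · rintro ⟨hv, y, hy, hvy⟩
      obtain ⟨F, hF, hFy⟩ := hexch j hj' y hy
      refine ⟨F, hF, ?_⟩
      have hv' : v ∈ chainSimplex r x.toFinset ∩ chainSimplex r y.toFinset := ⟨hv, hvy⟩
      rw [hr.chainSimplex_inter hP hxc ((hearlier j hj' y hy).1.isFaceChain hP)] at hv'
      refine chainSimplex_mono (fun H hH => ?_) hv'
      rw [Finset.mem_inter, List.mem_toFinset, List.mem_toFinset] at hH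
      refine Finset.mem_erase.2 ⟨?_, List.mem_toFinset.2 hH.1⟩
      rintro rfl
      exact hFy hH.2
    · rintro ⟨F, hF, hv⟩
      obtain ⟨hFx, z, hz, hFz, hsub⟩ := (hfront _ _ _).1 hF
      refine ⟨chainSimplex_mono (Finset.erase_subset _ _) hv, z, hz, chainSimplex_mono ?_ hv⟩
      intro H hH
      obtain ⟨h1, h2⟩ := Finset.mem_erase.1 hH
      exact List.mem_toFinset.2 (hsub H (List.mem_toFinset.1 h2) h1)

end FlagComplex

/-! ### From faces of cones to faces of their sections. -/

section Cones

variable {V : Type*} [NormedAddCommGroup V] [NormedSpace ℝ V]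
  {l : V →ₗ[ℝ] ℝ} {P : Set V} {σ : PointedCone ℝ V} {ρ : PointedCone ℝ V → V}

lemma hull_convexHull (s : Set V) :
    PointedCone.hull ℝ (convexHull ℝ s) = PointedCone.hull ℝ s := by
  apply le_antisymm
  · exact Submodule.span_le.2
      (convexHull_min (fun x hx => Submodule.subset_span hx) (PointedCone.convex _))
  · exact Submodule.span_mono (subset_convexHull ℝ s)

lemma coneDim_hull (s : Set V) :
    coneDim (PointedCone.hull ℝ s) = Module.finrank ℝ (Submodule.span ℝ s) := by
  unfold coneDim
  have : Submodule.span ℝ (PointedCone.hull ℝ s : Set V) = Submodule.span ℝ s := by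
    apply le_antisymm
    · exact Submodule.span_le.2 (PointedCone.hull_le_span ℝ s)
    · exact Submodule.span_mono PointedCone.subset_hull
  rw [this]

/-- The section of a pointed polyhedral cone is a polytope that spans the cone. -/
lemma polytopeIn_coneSection (hσ : σ.FG) (hl_nonneg : ∀ x ∈ σ, 0 ≤ l x)
    (hl_zero : ∀ x ∈ σ, l x = 0 → x = 0) :
    PolytopeIn l (coneSection l σ) ∧ PointedCone.hull ℝ (coneSection l σ) = σ := by
  classical
  obtain ⟨S, rfl⟩ := hσ
  have hS : ∀ x ∈ S, x ∈ PointedCone.hull ℝ (S : Set V) := fun x hx =>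
    Submodule.subset_span hx
  let s : Finset V := (S.filter (fun x => x ≠ 0)).image (fun x => (l x)⁻¹ • x)
  have hpos : ∀ x ∈ S, x ≠ 0 → 0 < l x := fun x hx h0 =>
    lt_of_le_of_ne (hl_nonneg x (hS x hx)) fun h => h0 (hl_zero x (hS x hx) h.symm)
  have hQ : PolytopeIn l (convexHull ℝ (s : Set V)) := by
    refine ⟨s, rfl, fun x hx => ?_⟩
    obtain ⟨y, hy, rfl⟩ := Finset.mem_image.1 hx
    obtain ⟨hyS, hy0⟩ := Finset.mem_filter.1 hy
    simp [(hpos y hyS hy0).ne']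
  have hhull : PointedCone.hull ℝ (convexHull ℝ (s : Set V)) =
      Submodule.span _ (S : Set V) := by
    rw [hull_convexHull]
    apply le_antisymm
    · refine Submodule.span_le.2 fun x hx => ?_
      obtain ⟨y, hy, rfl⟩ := Finset.mem_image.1 hx
      obtain ⟨hyS, hy0⟩ := Finset.mem_filter.1 hy
      exact PointedCone.smul_mem _ (inv_nonneg.2 (hpos y hyS hy0).le) (hS y hyS)
    · refine Submodule.span_le.2 fun x hx => ?_
      by_cases hx0 : x = 0
      · rw [hx0]; exact Submodule.zero_mem _
      · have hlx := hpos x hx hx0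
        have h1 : (l x)⁻¹ • x ∈ PointedCone.hull ℝ (s : Set V) :=
          Submodule.subset_span (Finset.mem_image.2 ⟨x, Finset.mem_filter.2 ⟨hx, hx0⟩, rfl⟩)
        have h2 := PointedCone.smul_mem _ hlx.le h1
        rwa [smul_smul, mul_inv_cancel₀ hlx.ne', one_smul] at h2
  have hsec : coneSection l (Submodule.span _ (S : Set V)) = convexHull ℝ (s : Set V) := by
    rw [← hhull, hQ.coneSection_hull]
  rw [hsec]
  exact ⟨hQ, hhull⟩

lemma PolytopeIn.isFaceOf_hull (hP : PolytopeIn l P) {F : Set V} {a : V →ₗ[ℝ] ℝ}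
    (ha : Cuts a P F) : (PointedCone.hull ℝ F).IsFaceOf (PointedCone.hull ℝ P) where
  le := Submodule.span_mono ha.subset
  mem_of_smul_add_mem := by
    intro x y c hx hy hc hmem
    have h0 : a (c • x + y) = 0 := by
      rcases (hP.of_cuts ha).mem_hull_iff.1 hmem with h | ⟨t, -, p, hp, h⟩
      · rw [h, map_zero]
      · rw [h, map_smul, ha.eq_zero hp, smul_zero]
    have hax := hP.hull_nonneg ha.nonneg hx
    have hay := hP.hull_nonneg ha.nonneg hy
    rw [map_add, map_smul, smul_eq_mul] at h0
    have hx0 : a x = 0 := by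
      by_contra hne
      have := mul_pos hc (lt_of_le_of_ne hax (Ne.symm hne))
      linarith
    rcases hP.mem_hull_iff.1 hx with rfl | ⟨t, ht, p, hp, rfl⟩
    · exact Submodule.zero_mem _
    · refine PointedCone.smul_mem _ ht.le (Submodule.subset_span ((ha.mem_iff p).2 ⟨hp, ?_⟩))
      rw [map_smul, smul_eq_mul] at hx0
      exact (mul_eq_zero.1 hx0).resolve_left ht.ne'

lemma PolytopeIn.hull_coneSection_of_le (hP : PolytopeIn l P) {τ : PointedCone ℝ V}
    (hτ : τ ≤ PointedCone.hull ℝ P) : PointedCone.hull ℝ (coneSection l τ) = τ := by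
  apply le_antisymm
  · exact Submodule.span_le.2 fun x hx => hx.1
  · intro x hx
    rcases hP.mem_hull_iff.1 (hτ hx) with rfl | ⟨t, ht, p, hp, rfl⟩
    · exact Submodule.zero_mem _
    · refine PointedCone.smul_mem _ ht.le (Submodule.subset_span ⟨?_, hP.apply_eq_one hp⟩)
      have := PointedCone.smul_mem τ (inv_nonneg.2 ht.le) hx
      rwa [smul_smul, inv_mul_cancel₀ ht.ne', one_smul] at this

/-- A point in the relative interior of a cone lies on no proper exposed face. -/
lemma eq_zero_of_mem_intrinsicInterior {τ : PointedCone ℝ V} {b : V →ₗ[ℝ] ℝ}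
    (hb : ∀ x ∈ τ, 0 ≤ b x) {z : V} (hz : z ∈ intrinsicInterior ℝ (τ : Set V)) (hbz : b z = 0)
    {y : V} (hy : y ∈ τ) : b y = 0 := by
  obtain ⟨z', hz', rfl⟩ := mem_intrinsicInterior.1 hz
  -- The segment from `y` to `z'` is prolonged slightly beyond `z'`; at parameter `-t` the value of
  -- `b` is `-t * b y`, which must still be nonnegative.
  let φ : ℝ → affineSpan ℝ (τ : Set V) := fun t =>
    ⟨AffineMap.lineMap (z' : V) y (-t),
      AffineMap.lineMap_mem _ z'.2 (subset_affineSpan ℝ _ hy)⟩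
  have hφ : Continuous φ := by
    refine Continuous.subtype_mk ?_ _
    simp only [AffineMap.lineMap_apply_module']
    fun_prop
  have hφ0 : φ 0 = z' := by ext; simp [φ]
  have hev : ∀ᶠ t in nhds (0 : ℝ), φ t ∈ interior ((↑) ⁻¹' (τ : Set V)) := by
    refine hφ.continuousAt.eventually ?_
    rw [hφ0]
    exact isOpen_interior.mem_nhds hz'
  obtain ⟨t, ht, htpos⟩ := ((hev.filter_mono nhdsWithin_le_nhds).and
    (self_mem_nhdsWithin (a := (0 : ℝ)) (s := Ioi 0))).exists
  have htpos : 0 < t := htpos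
  have hmem : AffineMap.lineMap (z' : V) y (-t) ∈ τ := by
    have h : φ t ∈ Subtype.val ⁻¹' (τ : Set V) := interior_subset ht
    exact h
  have h1 := hb _ hmem
  rw [AffineMap.lineMap_apply_module'] at h1
  simp only [map_add, map_smul, map_sub, hbz, smul_eq_mul] at h1
  have h2 := hb y hy
  nlinarith

lemma isBarycenter_of_intrinsicInterior (hP : PolytopeIn l P)
    (hρ : ∀ μ : PointedCone ℝ V, μ.IsFaceOf (PointedCone.hull ℝ P) → μ ≠ ⊥ →
      ρ μ ∈ coneSection l (PointedCone.hull ℝ P) ∧ ρ μ ∈ intrinsicInterior ℝ (μ : Set V)) :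
    IsBarycenter P (fun F => ρ (PointedCone.hull ℝ F)) := by
  have key : ∀ (F : Set V) (a : V →ₗ[ℝ] ℝ), Cuts a P F → F.Nonempty →
      ρ (PointedCone.hull ℝ F) ∈ coneSection l (PointedCone.hull ℝ P) ∧
        ρ (PointedCone.hull ℝ F) ∈ intrinsicInterior ℝ (PointedCone.hull ℝ F : Set V) := by
    rintro F a ha ⟨x, hx⟩
    refine hρ _ (hP.isFaceOf_hull ha) fun hbot => ?_
    have h1 : x ∈ PointedCone.hull ℝ F := Submodule.subset_span hx
    rw [hbot] at h1
    exact hP.ne_zero_of_mem (ha.subset hx) ((Submodule.mem_bot _).1 h1)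
  constructor
  · intro F a ha hF
    obtain ⟨h1, h2⟩ := key F a ha hF
    have h3 : ρ (PointedCone.hull ℝ F) ∈ coneSection l (PointedCone.hull ℝ F) :=
      ⟨intrinsicInterior_subset h2, h1.2⟩
    rwa [(hP.of_cuts ha).coneSection_hull] at h3
  · intro F G a b ha hF hb hG y hy
    have hbF : ∀ x ∈ PointedCone.hull ℝ F, 0 ≤ b x := fun x hx =>
      (hP.of_cuts ha).hull_nonneg (fun x hx => hb.nonneg x (ha.subset hx)) hx
    exact (hb.mem_iff y).2 ⟨ha.subset hy, eq_zero_of_mem_intrinsicInterior hbF (key F a ha hF).2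
      (hb.eq_zero hG) (Submodule.subset_span hy)⟩

variable [FiniteDimensional ℝ V]

/-- Faces of a polyhedral cone are exposed. -/
lemma PolytopeIn.exists_cuts_of_isFaceOf (hP : PolytopeIn l P) {τ : PointedCone ℝ V}
    (hτ : τ.IsFaceOf (PointedCone.hull ℝ P)) :
    ∃ a : V →ₗ[ℝ] ℝ, Cuts a P (coneSection l τ) := by
  have hsub : coneSection l τ ⊆ P := fun x hx =>
    hP.coneSection_hull.subset ⟨hτ.le hx.1, hx.2⟩
  let S : Set (Set V) := {E | (∃ a : V →ₗ[ℝ] ℝ, Cuts a P E) ∧ coneSection l τ ⊆ E}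
  have hS : S.Finite := hP.finite_faces.subset fun E hE => hE.1
  -- `E` is a minimal exposed face containing the section of `τ`. By minimality each facet of `E`
  -- misses some point of that section, and the sum of such points is an `x ∈ τ` interior to the
  -- cone over `E`. For `y ∈ E`, small `ε` leaves `x - ε • y` in that cone, and the face property
  -- puts `y` in `τ`.
  obtain ⟨E, hE⟩ := hS.exists_minimal ⟨P, ⟨0, Cuts.self P⟩, hsub⟩
  obtain ⟨⟨a, ha⟩, hτE⟩ := hE.1
  have hEp := hP.of_cuts ha
  suffices h : E ⊆ coneSection l τ by
    rw [Subset.antisymm hτE h]; exact ⟨a, ha⟩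
  choose! A hA using fun (G : Set V) (hG : FacetOf G E) => hG.exists_cuts hEp
  have hex : ∀ G, FacetOf G E → ∃ x ∈ coneSection l τ, 0 < A G x := by
    intro G hG
    by_contra hcon
    push Not at hcon
    have hGS : G ∈ S := by
      refine ⟨hP.cuts_trans ha (hA G hG), fun x hx => ((hA G hG).mem_iff x).2 ⟨hτE hx, ?_⟩⟩
      exact le_antisymm (hcon x hx) ((hA G hG).nonneg x (hτE hx))
    exact hG.ne (Subset.antisymm hG.subset (hE.2 hGS hG.subset))
  choose! p hpτ hp using hex
  let x : V := ∑ G ∈ hEp.finite_facets.toFinset, p G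
  have hxτ : x ∈ τ := Submodule.sum_mem _ fun G hG => (hpτ G (by simpa using hG)).1
  have hxE : x ∈ Submodule.span ℝ E := Submodule.sum_mem _ fun G hG =>
    Submodule.subset_span (hτE (hpτ G (by simpa using hG)))
  have hxpos : ∀ G, FacetOf G E → 0 < A G x := by
    intro G hG
    rw [map_sum]
    refine Finset.sum_pos' (fun H hH => (hA G hG).nonneg _ (hτE (hpτ H (by simpa using hH))))
      ⟨G, by simpa using hG, hp G hG⟩
  intro y hy
  refine ⟨?_, hEp.apply_eq_one hy⟩
  have hev : ∀ᶠ ε in nhdsWithin (0 : ℝ) (Ioi 0), ∀ G ∈ hEp.finite_facets.toFinset,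
      0 < A G (x - ε • y) := by
    rw [Filter.eventually_all_finset]
    intro G hG
    have hG : FacetOf G E := by simpa using hG
    have hcont : ContinuousAt (fun ε : ℝ => A G (x - ε • y)) 0 := by
      have : (fun ε : ℝ => A G (x - ε • y)) = fun ε => A G x - ε * A G y := by
        ext ε; simp
      rw [this]; fun_prop
    refine (hcont.eventually (lt_mem_nhds ?_)).filter_mono nhdsWithin_le_nhds
    simpa using hxpos G hG
  obtain ⟨ε, hε, hεpos⟩ := (hev.and self_mem_nhdsWithin).exists
  have hspan : x - ε • y ∈ Submodule.span ℝ E :=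
    Submodule.sub_mem _ hxE (Submodule.smul_mem _ _ (Submodule.subset_span hy))
  have hmem : x - ε • y ∈ PointedCone.hull ℝ E := by
    refine hEp.mem_hull_of_pos hspan fun G b hG hb => ?_
    obtain ⟨t, ht, h⟩ := hG.exists_pos_smul hEp (hA G hG) hb
    rw [h _ hspan]
    exact mul_pos ht (hε G (by simpa using hG))
  refine hτ.mem_of_smul_add_mem (y := x - ε • y) (a := ε)
    (Submodule.subset_span (ha.subset hy)) (Submodule.span_mono ha.subset hmem) hεpos ?_
  simpa using hxτ

lemma IsConeFlag.exists_isCompleteFlag (hP : PolytopeIn l P) (hne : P.Nonempty)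
    (hσ : PointedCone.hull ℝ P = σ) {μ : Fin (coneDim σ) → PointedCone ℝ V}
    (hμ : IsConeFlag σ μ) :
    ∃ x, IsCompleteFlag P x ∧ Set.range μ = PointedCone.hull ℝ '' {F | F ∈ x} := by
  subst hσ
  obtain ⟨hmono, hface⟩ := hμ
  have hd : coneDim (PointedCone.hull ℝ P) = Module.finrank ℝ (Submodule.span ℝ P) :=
    coneDim_hull P
  have hpos := hP.finrank_pos_iff.2 hne
  have hcut : ∀ i, ∃ a : V →ₗ[ℝ] ℝ, Cuts a P (coneSection l (μ i)) := fun i =>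
    hP.exists_cuts_of_isFaceOf (hface i).1
  have hhull : ∀ i, PointedCone.hull ℝ (coneSection l (μ i)) = μ i := fun i =>
    hP.hull_coneSection_of_le (hface i).1.le
  have hdim : ∀ i, Module.finrank ℝ (Submodule.span ℝ (coneSection l (μ i))) = (i : ℕ) + 1 := by
    intro i
    rw [← coneDim_hull, hhull, (hface i).2]
  -- Cone flags ascend and polytope flags descend, hence the reversal; `coneDim` of a face is the
  -- rank of its section's span.
  let x : List (Set V) := List.ofFn fun i => coneSection l (μ i.rev)
  have hlen : x.length = coneDim (PointedCone.hull ℝ P) := List.length_ofFn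
  refine ⟨x, (isCompleteFlag_iff hP).2 ⟨⟨?_, ?_⟩, hlen.trans hd⟩, ?_⟩
  · have h0 : 0 < coneDim (PointedCone.hull ℝ P) := hd ▸ hpos
    have hhead : x.head? = some (coneSection l (μ (Fin.rev ⟨0, h0⟩))) := by
      rw [List.head?_eq_getElem?, List.getElem?_eq_getElem (by rw [hlen]; exact h0)]
      simp [x]
    rw [hhead]
    congr 1
    obtain ⟨a, ha⟩ := hcut (Fin.rev ⟨0, h0⟩)
    by_contra hne
    have h1 := ha.finrank_lt hne
    rw [hdim, Fin.val_rev] at h1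
    simp only at h1
    omega
  · rw [List.isChain_iff_getElem]
    intro i hi
    change FacetOf _ _
    rw [hlen] at hi
    simp only [x, List.getElem_ofFn]
    obtain ⟨a, ha⟩ := hcut (Fin.rev ⟨i, by omega⟩)
    obtain ⟨b, hb⟩ := hcut (Fin.rev ⟨i + 1, hi⟩)
    have hle : coneSection l (μ (Fin.rev ⟨i + 1, hi⟩)) ⊆
        coneSection l (μ (Fin.rev ⟨i, by omega⟩)) := by
      intro v hv
      refine ⟨hmono ?_ hv.1, hv.2⟩
      rw [Fin.rev_le_rev]
      simp
    have e1 := hdim (Fin.rev ⟨i, by omega⟩)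
    have e2 := hdim (Fin.rev ⟨i + 1, hi⟩)
    rw [Fin.val_rev] at e1 e2
    simp only at e1 e2
    refine (hP.of_cuts ha).facetOf_of_finrank (hb.restrict_of_subset ha.subset hle) ?_ ?_
    · intro heq
      rw [heq] at e2
      omega
    · omega
  · ext τ
    simp only [mem_range, mem_image, mem_ofPred_eq, x, List.mem_ofFn]
    constructor
    · rintro ⟨i, rfl⟩
      exact ⟨_, ⟨i.rev, rfl⟩, by rw [Fin.rev_rev, hhull]⟩
    · rintro ⟨_, ⟨i, rfl⟩, rfl⟩
      exact ⟨i.rev, (hhull _).symm⟩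

lemma IsCompleteFlag.exists_isConeFlag (hP : PolytopeIn l P)
    (hσ : PointedCone.hull ℝ P = σ) {x : List (Set V)} (hx : IsCompleteFlag P x) :
    ∃ μ : Fin (coneDim σ) → PointedCone ℝ V, IsConeFlag σ μ ∧
      Set.range μ = PointedCone.hull ℝ '' {F | F ∈ x} := by
  subst hσ
  have hlen : x.length = coneDim (PointedCone.hull ℝ P) :=
    ((isCompleteFlag_iff hP).1 hx).2.trans (coneDim_hull P).symm
  have hlt : ∀ i : Fin (coneDim (PointedCone.hull ℝ P)), (i : ℕ) < x.length := fun i => by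
    rw [hlen]; exact i.2
  refine ⟨fun i => PointedCone.hull ℝ (x[(i.rev : ℕ)]'(hlt _)), ⟨?_, fun i => ⟨?_, ?_⟩⟩, ?_⟩
  · intro i j hij
    refine Submodule.span_mono ?_
    rcases (Fin.rev_le_rev.2 hij).eq_or_lt with h | h
    · simp only [h]; exact subset_rfl
    · exact (List.pairwise_iff_getElem.1 hx.1.pairwise _ _ (hlt _) (hlt _) h).subset
  · obtain ⟨a, ha⟩ := hx.1.exists_cuts hP (List.getElem_mem (hlt i.rev))
    exact hP.isFaceOf_hull ha
  · rw [coneDim_hull]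
    have hsplit : x = x.take i.rev ++ x[(i.rev : ℕ)]'(hlt _) :: x.drop (i.rev + 1) := by
      rw [← List.drop_eq_getElem_cons (hlt i.rev), List.take_append_drop]
    have hc := hx.1
    rw [hsplit] at hc
    have h1 := hc.finrank_of_append hP
    rw [List.length_take, min_eq_left (hlt _).le, ← coneDim_hull P] at h1
    have h2 := Fin.val_rev i
    have h3 := i.2
    omega
  · ext τ
    simp only [mem_range, mem_image, mem_ofPred_eq]
    constructor
    · rintro ⟨i, rfl⟩
      exact ⟨_, List.getElem_mem _, rfl⟩
    · rintro ⟨F, hF, rfl⟩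
      obtain ⟨k, hk, rfl⟩ := List.getElem_of_mem hF
      exact ⟨Fin.rev ⟨k, hlen ▸ hk⟩, by simp⟩

/-- Each maximal cone is the hull of a flag simplex. Its faces are exposed, so their sections are
the faces of that simplex, namely the simplices on subsets of the flag. -/
lemma barycentricComplex_eq_flagComplex (hP : PolytopeIn l P) (hne : P.Nonempty)
    (hσ : PointedCone.hull ℝ P = σ) (hr : IsBarycenter P (fun F => ρ (PointedCone.hull ℝ F))) :
    barycentricComplex σ l ρ = flagComplex P (fun F => ρ (PointedCone.hull ℝ F)) := by
  classical
  have hhull : ∀ (μ : Fin (coneDim σ) → PointedCone ℝ V) (x : List (Set V)),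
      Set.range μ = PointedCone.hull ℝ '' {F | F ∈ x} →
      PointedCone.hull ℝ (Set.range fun i => ρ (μ i)) =
        PointedCone.hull ℝ (chainSimplex (fun F => ρ (PointedCone.hull ℝ F)) x.toFinset) := by
    intro μ x h
    rw [chainSimplex, hull_convexHull]
    have h1 : (Set.range fun i => ρ (μ i)) = ρ '' Set.range μ := by
      rw [← Set.range_comp]; rfl
    rw [h1, h, image_image]
    congr 2
    ext F; simp
  ext K
  constructor
  · rintro ⟨τ, ⟨μ, hμ, hτ⟩, rfl⟩
    obtain ⟨x, hx, hμx⟩ := hμ.exists_isCompleteFlag hP hne hσ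
    have hxc := hx.isFaceChain hP
    rw [hhull μ x hμx] at hτ
    obtain ⟨S, hS, hSeq⟩ := (hr.exists_cuts_chainSimplex_iff hP hxc _).1
      ((hr.polytopeIn_chainSimplex hP hxc).exists_cuts_of_isFaceOf hτ)
    exact ⟨x, hx, S, fun F hF => by simpa using hS hF, hSeq⟩
  · rintro ⟨x, hx, S, hS, rfl⟩
    have hS' : S ⊆ x.toFinset := fun F hF => by simpa using hS hF
    obtain ⟨μ, hμ, hμx⟩ := hx.exists_isConeFlag hP hσ
    have hxc := hx.isFaceChain hP
    obtain ⟨a, ha⟩ := (hr.exists_cuts_chainSimplex_iff hP hxc _).2 ⟨S, hS', rfl⟩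
    refine ⟨_, ⟨μ, hμ, ?_⟩, (hr.polytopeIn_chainSimplex hP (hxc.mono hS')).coneSection_hull⟩
    rw [hhull μ x hμx]
    exact (hr.polytopeIn_chainSimplex hP hxc).isFaceOf_hull ha

end Cones

theorem proposition2p10 {V : Type*} [NormedAddCommGroup V] [NormedSpace ℝ V]
    [FiniteDimensional ℝ V]
    -- a nonzero polyhedral cone, and a linear functional that is positive on it away from `0`
    (σ : PointedCone ℝ V) (hσ : σ.FG) (hσ0 : σ ≠ ⊥)
    (l : V →ₗ[ℝ] ℝ) (hl_nonneg : ∀ x ∈ σ, 0 ≤ l x) (hl_zero : ∀ x ∈ σ, l x = 0 → x = 0)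
    -- a point of `σ ∩ {l = 1}` in the relative interior of each nonzero face of `σ`
    (ρ : PointedCone ℝ V → V)
    (hρ : ∀ μ : PointedCone ℝ V, μ.IsFaceOf σ → μ ≠ ⊥ →
      ρ μ ∈ coneSection l σ ∧ ρ μ ∈ intrinsicInterior ℝ (μ : Set V)) :
    IsSimplicialComplex (barycentricComplex σ l ρ) ∧
    IsShellable (barycentricComplex σ l ρ) ∧
    -- the recursive choice of shellings is possible
    (∃ ord, IsRecursiveShelling (coneSection l σ) ord) ∧
    -- and for every such choice the lexicographic order on complete flags gives a shelling
    (∀ ord, IsRecursiveShelling (coneSection l σ) ord →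
      ∃ L, IsLexFlagList (coneSection l σ) ord L ∧
        IsShelling (barycentricComplex σ l ρ) (L.map (flagSimplex ρ))) := by
  classical
  obtain ⟨hP, hhull⟩ := polytopeIn_coneSection hσ hl_nonneg hl_zero
  have hne : (coneSection l σ).Nonempty := by
    rw [nonempty_iff_ne_empty]
    intro hempty
    rw [hempty] at hhull
    exact hσ0 (hhull.symm.trans Submodule.span_empty)
  have hr : IsBarycenter (coneSection l σ) (fun F => ρ (PointedCone.hull ℝ F)) :=
    isBarycenter_of_intrinsicInterior hP (by rwa [hhull])
  have hshell : ∀ ord, IsRecursiveShelling (coneSection l σ) ord →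
      ∃ L, IsLexFlagList (coneSection l σ) ord L ∧
        IsShelling (barycentricComplex σ l ρ) (L.map (flagSimplex ρ)) := by
    intro ord hord
    obtain ⟨L, hL⟩ := exists_isLexFlagList hord hP hne
    refine ⟨L, hL, ?_⟩
    rw [barycentricComplex_eq_flagComplex hP hne hhull hr,
      funext (flagSimplex_eq_chainSimplex (ρ := ρ))]
    exact hr.isShelling_flagComplex hP hord hL
  obtain ⟨ord, hord⟩ := exists_isRecursiveShelling hP
  refine ⟨?_, ⟨?_, ?_, ?_⟩, ⟨ord, hord⟩, hshell⟩
  · rw [barycentricComplex_eq_flagComplex hP hne hhull hr]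
    exact hr.isSimplicialComplex_flagComplex hP
  · rw [barycentricComplex_eq_flagComplex hP hne hhull hr]
    exact hr.isPolytopalComplex_flagComplex hP hne
  · rw [barycentricComplex_eq_flagComplex hP hne hhull hr]
    exact hr.isPureComplex_flagComplex hP hne
  · obtain ⟨L, -, hL⟩ := hshell ord hord
    exact ⟨_, hL⟩
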